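/- Let $d(l,\lambda)$ ($l\in\mathbb N$, $\lambda\in\mathbb C$) be the functional $f\mapsto f^{(l)}(\lambda)$, and let $\mathcal C$ be the complex vector space with basis all $d(l,\lambda)$. Let $\mu:\mathbb C\to\mathbb N$ have finite support, $\dim\mu=\sum_\lambda\mu(\lambda)$, and let $\mathcal C(\mu)\subset\mathcal C$ be spanned by the $d(l,\lambda)$ with $l<\mu(\lambda)$. For a finite-dimensional $C\subset\mathcal C$ put $V_C=\{f\in\mathbb C[z]: c(f)=0\ \forall c\in C\}$ and $A_C=\{p\in\mathbb C[z]: pV_C\subseteq V_C\}$. The spectral curve $X_C$ is $\operatorname{Spec}A_C$ completed by one smooth point at infinity; a curve is \emph{represented by $M$ conditions bounded by $\mu$} if it is $X_C$ for some $C\subset\mathcal C(\mu)$ with $\dim C=M$. Its generalized Jacobian $\operatorname{Jac}(X_C)$ is the algebraic group of divisors of degree $0$ on the smooth part of $X_C$ modulo divisors of rational functions that are invertible in the local rings at the singular points; its algebraic structure is the one defined by the Abel maps $E\mapsto[E-n\infty]$ on effective divisors $E$ of degree $n$ on the smooth part of $\operatorname{Spec}A_C$. Let $\Gamma_+$ be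 the multiplicative group generated by the functions $e^{cz^n}$ ($c\in\mathbb C$, $n\ge1$), acting linearly on $\mathcal C$ by $(g\cdot d(l,\lambda))(f)=(f/g)^{(l)}(\lambda)$. **Proposition.** Let $M\le N$ be natural numbers and let $\mu$ be any function as above with $\dim\mu=N$. Then $\mathcal C(\mu)\cong\mathbb C^N$, and under any linear isomorphism $\mathbb C^N\cong\mathcal C(\mu)$, which identifies the Grassmannian $\mathrm{Gr}(M,N)$ of $M$-dimensional subspaces of $\mathbb C^N$ with that of $\mathcal C(\mu)$, the following hold. 1. $\Gamma_+$ preserves $\mathrm{Gr}(M,N)$, which is the disjoint union of the $\Gamma_+$-orbits. 2. For every orbit $O$ there is a curve $X$ represented by $M$ conditions bounded by $\mu$ such that $X_C=X$ for all $C\in O$ and $O$ is isomorphic to $\operatorname{Jac}(X)$: for every $C\in O$ there are a bijection $\Phi:\operatorname{Jac}(X)\to O$, regular in both directions, and a group homomorphism $\kappa:\Gamma_+\to\operatorname{Jac}(X)$ with $\Phi(\kappa(g))=g\cdot C$ for all $g\in\Gamma_+$. 3. Every curve represented by $M$ conditions bounded by $\mu$ occurs as the curve $X$ of some orbit $O$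 in 2. -/

import Mathlib

open Polynomial

noncomputable section

namespace DualGr

/-! ## Differential conditions and bounding functions -/

/-- The functional `d(l, a) : f ↦ f⁽ˡ⁾(a)` on `ℂ[z]`, indexed by the pair `(a, l)`. -/
def d (x : ℂ × ℕ) : Module.Dual ℂ ℂ[X] :=
  (Polynomial.leval x.1) ∘ₗ ((Polynomial.derivative : ℂ[X] →ₗ[ℂ] ℂ[X]) ^ x.2)

/-- The space `𝒞` of finite differential conditions: the complex vector space generated by all
`d(l, a)`; the generator `d(l, a)` is `Finsupp.single (a, l) 1`. -/
abbrev Cond : Type := (ℂ × ℕ) →₀ ℂ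

/-- A condition applied to a polynomial. -/
def applyCond : Cond →ₗ[ℂ] Module.Dual ℂ ℂ[X] :=
  Finsupp.linearCombination ℂ d

/-- The dimension `∑ μ(a)` of a singularity bounding function `μ : ℂ → ℕ` of finite support. -/
def dimBound (μ : ℂ →₀ ℕ) : ℕ := μ.sum fun _ m => m

/-- `𝒞(μ)`, the span of the `d(l, a)` with `l < μ(a)`. -/
def boundedCond (μ : ℂ →₀ ℕ) : Submodule ℂ Cond :=
  Finsupp.supported ℂ ℂ {x : ℂ × ℕ | x.2 < μ x.1}

/-- `V_C`, the polynomials that satisfy all conditions in `C`. -/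
def solutions (C : Submodule ℂ Cond) : Submodule ℂ ℂ[X] where
  carrier := {f | ∀ c ∈ C, applyCond c f = 0}
  zero_mem' := by intro c _; simp
  add_mem' := by intro f g hf hg c hc; simp [hf c hc, hg c hc]
  smul_mem' := by intro a f hf c hc; simp [hf c hc]

/-! ## Spectral curves and their generalized Jacobians -/

/-- The coordinate ring `{p | p V_C ⊆ V_C}` of the affine part of the spectral curve of `C`.
The spectral curve is completed by one smooth point at infinity and its normalization is the
projective line. -/
def spectralRing (C : Submodule ℂ Cond) : Subalgebra ℂ ℂ[X] where
  carrier := {p | ∀ f ∈ solutions C, p * f ∈ solutions C}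
  mul_mem' := by
    intro p q hp hq f hf
    rw [mul_assoc]
    exact hp _ (hq _ hf)
  add_mem' := by
    intro p q hp hq f hf
    rw [add_mul]
    exact (solutions C).add_mem (hp _ hf) (hq _ hf)
  algebraMap_mem' := by
    intro a f hf
    rw [← Algebra.smul_def]
    exact (solutions C).smul_mem a hf

/-- `A` is (the affine coordinate ring of) a curve represented by `M` conditions bounded by `μ`. -/
def IsCurveOf (M : ℕ) (μ : ℂ →₀ ℕ) (A : Subalgebra ℂ ℂ[X]) : Prop :=
  ∃ C : Submodule ℂ Cond, C ≤ boundedCond μ ∧ Module.finrank ℂ C = M ∧ spectralRing C = A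

/-- The points of the affine line that lie over singular points of the curve with coordinate ring
`A`: the common zeros of the conductor `{p | p ℂ[z] ⊆ A}`. -/
def singSet (A : Subalgebra ℂ ℂ[X]) : Set ℂ :=
  {a | ∀ p : ℂ[X], (∀ f : ℂ[X], p * f ∈ A) → p.eval a = 0}

/-- The divisor on the projective line of a nonzero polynomial. -/
def polyDiv (p : ℂ[X]) : OnePoint ℂ →₀ ℤ :=
  (p.roots.map fun a : ℂ => Finsupp.single (a : OnePoint ℂ) (1 : ℤ)).sum
    - Finsupp.single OnePoint.infty (p.natDegree : ℤ)

/-- Divisors of degree zero on the smooth part of the complete curve with affine coordinate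
ring `A`. -/
def divZero (A : Subalgebra ℂ ℂ[X]) : AddSubgroup (OnePoint ℂ →₀ ℤ) where
  carrier := {D | D.degree = 0 ∧ ∀ a ∈ singSet A, D (a : OnePoint ℂ) = 0}
  zero_mem' := by simp
  add_mem' := by
    rintro D E ⟨h1, h2⟩ ⟨h3, h4⟩
    refine ⟨by rw [map_add, h1, h3, add_zero], fun a ha => ?_⟩
    rw [Finsupp.add_apply, h2 a ha, h4 a ha, add_zero]
  neg_mem' := by
    rintro D ⟨h1, h2⟩
    refine ⟨?_, fun a ha => ?_⟩
    · have h : (-D).degree + D.degree = 0 := by rw [← map_add, neg_add_cancel, map_zero]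
      rwa [h1, add_zero] at h
    · rw [Finsupp.neg_apply, h2 a ha, neg_zero]

/-- `p` is an element of `A` that is invertible in the local rings at all singular points. -/
def IsUnitAtSing (A : Subalgebra ℂ ℂ[X]) (p : ℂ[X]) : Prop :=
  p ∈ A ∧ p ≠ 0 ∧ ∀ a ∈ singSet A, p.eval a ≠ 0

theorem polyDiv_mul {p q : ℂ[X]} (hp : p ≠ 0) (hq : q ≠ 0) :
    polyDiv (p * q) = polyDiv p + polyDiv q := by
  unfold polyDiv
  rw [Polynomial.roots_mul (mul_ne_zero hp hq), Polynomial.natDegree_mul hp hq,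
    Multiset.map_add, Multiset.sum_add, Nat.cast_add, Finsupp.single_add]
  abel

theorem IsUnitAtSing.mul {A : Subalgebra ℂ ℂ[X]} {p q : ℂ[X]} (hp : IsUnitAtSing A p)
    (hq : IsUnitAtSing A q) : IsUnitAtSing A (p * q) :=
  ⟨A.mul_mem hp.1 hq.1, mul_ne_zero hp.2.1 hq.2.1, fun a ha => by
    rw [Polynomial.eval_mul]; exact mul_ne_zero (hp.2.2 a ha) (hq.2.2 a ha)⟩

/-- The divisors of the rational functions `p / q` on the curve that are invertible in the local
rings at all singular points. -/
def principalDiv (A : Subalgebra ℂ ℂ[X]) : AddSubgroup (OnePoint ℂ →₀ ℤ) where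
  carrier := {D | ∃ p q : ℂ[X], IsUnitAtSing A p ∧ IsUnitAtSing A q ∧
    D = polyDiv p - polyDiv q}
  zero_mem' := ⟨1, 1, ⟨A.one_mem, one_ne_zero, by simp⟩, ⟨A.one_mem, one_ne_zero, by simp⟩,
    by simp⟩
  add_mem' := by
    rintro D E ⟨p, q, hp, hq, rfl⟩ ⟨r, s, hr, hs, rfl⟩
    refine ⟨p * r, q * s, hp.mul hr, hq.mul hs, ?_⟩
    rw [polyDiv_mul hp.2.1 hr.2.1, polyDiv_mul hq.2.1 hs.2.1]
    abel
  neg_mem' := by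
    rintro D ⟨p, q, hp, hq, rfl⟩
    exact ⟨q, p, hq, hp, by abel⟩

/-- The generalized Jacobian (Rosenlicht, Serre) of the complete curve with affine coordinate
ring `A`: divisors of degree zero on the smooth part modulo divisors of rational functions that
are invertible at the singular points. -/
abbrev Jac (A : Subalgebra ℂ ℂ[X]) : Type :=
  divZero A ⧸ (principalDiv A).addSubgroupOf (divZero A)

theorem polyDiv_mem (A : Subalgebra ℂ ℂ[X]) {p : ℂ[X]}
    (hp : ∀ a ∈ singSet A, p.eval a ≠ 0) : polyDiv p ∈ divZero A := by
  classical
  have key : ∀ s : Multiset ℂ,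
      (s.map fun a : ℂ => Finsupp.single (a : OnePoint ℂ) (1 : ℤ)).sum.degree = (s.card : ℤ) := by
    intro s
    induction s using Multiset.induction_on with
    | empty => simp
    | cons a s ih => simp [ih, add_comm]
  have key2 : ∀ (s : Multiset ℂ) (b : ℂ), b ∉ s →
      (s.map fun a : ℂ => Finsupp.single (a : OnePoint ℂ) (1 : ℤ)).sum (b : OnePoint ℂ) = 0 := by
    intro s b
    induction s using Multiset.induction_on with
    | empty => simp
    | cons a s ih =>
      intro hb
      rw [Multiset.mem_cons, not_or] at hb
      have hab : (a : OnePoint ℂ) ≠ (b : OnePoint ℂ) := fun h =>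
        hb.1 (OnePoint.coe_injective h).symm
      simp [ih hb.2, hab]
  refine ⟨?_, fun a ha => ?_⟩
  · unfold polyDiv
    have h : p.roots.card = p.natDegree :=
      (Polynomial.splits_iff_card_roots.mp (IsAlgClosed.splits p))
    rw [map_sub, key, h, Finsupp.degree_single, sub_self]
  · unfold polyDiv
    rw [Finsupp.sub_apply, key2 _ _ (fun h => hp a ha (Polynomial.isRoot_of_mem_roots h)),
      Finsupp.single_apply, if_neg (OnePoint.infty_ne_coe a), sub_self]

/-! ## Algebraic structure -/

/-- A parametrization of (part of) a set `Y` by a subset of an affine space: `param x y` says that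
the point `x` belongs to that subset and is sent to `y`. -/
structure Parametrization (Y : Type*) where
  coord : Type
  param : (coord → ℂ) → Y → Prop

/-- `F` is a morphism for the algebraic structures given by families of parametrizations: locally
for the Zariski topology, it lifts to a map given by rational functions without poles. -/
def IsMorphism {Y Y' : Type*} (P : Set (Parametrization Y)) (P' : Set (Parametrization Y'))
    (F : Y → Y') : Prop :=
  ∀ π ∈ P, ∀ x y, π.param x y → ∃ π' ∈ P', ∃ (r : π'.coord → MvPolynomial π.coord ℂ)
    (q : MvPolynomial π.coord ℂ), MvPolynomial.eval x q ≠ 0 ∧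
      ∀ x' y', π.param x' y' → MvPolynomial.eval x' q ≠ 0 →
        π'.param (fun k => MvPolynomial.eval x' (r k) / MvPolynomial.eval x' q) (F y')

/-- The monic polynomial `zⁿ + ∑ aᵢ zⁱ`. -/
def monicPoly {n : ℕ} (a : Fin n → ℂ) : ℂ[X] := X ^ n + ∑ i, C (a i) * X ^ (i : ℕ)

/-- The Abel map `E ↦ [E - n∞]` on effective divisors `E` of degree `n` on the smooth part of the
affine curve; `E` is given by the coefficients of the monic polynomial with zero divisor `E`, that
is, by coordinates on the `n`-th symmetric power. -/
def abelMap (A : Subalgebra ℂ ℂ[X]) (n : ℕ) : Parametrization (Jac A) where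
  coord := Fin n
  param a j := ∃ h : ∀ s ∈ singSet A, (monicPoly a).eval s ≠ 0,
    j = QuotientAddGroup.mk ⟨polyDiv (monicPoly a), polyDiv_mem A h⟩

/-- The algebraic structure of the generalized Jacobian, given by its Abel maps. -/
def jacStructure (A : Subalgebra ℂ ℂ[X]) : Set (Parametrization (Jac A)) :=
  Set.range (abelMap A)

/-- The Grassmannian `Gr(M, N)` of `M`-dimensional subspaces of `ℂ^N`. -/
abbrev Gr (M N : ℕ) : Type := {W : Submodule ℂ (Fin N → ℂ) // Module.finrank ℂ W = M}

/-- The algebraic structure of a subset of `Gr(M, N)`: a subspace in it is given by the matrix of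
a basis. -/
def grStructure {M N : ℕ} (O : Set (Gr M N)) : Set (Parametrization O) :=
  {{ coord := Fin M × Fin N
     param := fun m W => Submodule.span ℂ (Set.range fun i k => m (i, k)) = W.1.1 }}

/-! ## The action of `Γ₊` -/

/-- The group `Γ₊` of the flows of the hierarchy: functions generated by the `e^{c zⁿ}`, `n ≥ 1`. -/
def gammaPlus : Subgroup (ℂ → ℂˣ) :=
  Subgroup.closure {g | ∃ (c : ℂ) (n : ℕ), 1 ≤ n ∧ ∀ z, (g z : ℂ) = Complex.exp (c * z ^ n)}

/-- The action of `g` on conditions, with `g(c)(g f) = c(f)`: the condition `g(d(l, a))` is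
`f ↦ (f / g)⁽ˡ⁾(a)`, written out by the Leibniz rule. -/
def act (g : ℂ → ℂˣ) : Cond →ₗ[ℂ] Cond :=
  Finsupp.linearCombination ℂ fun x : ℂ × ℕ =>
    ∑ i ∈ Finset.range (x.2 + 1),
      Finsupp.single (x.1, x.2 - i)
        ((x.2.choose i : ℂ) * iteratedDeriv i (fun z => ((g z)⁻¹ : ℂ)) x.1)

/-- The space of conditions bounded by `μ` that corresponds to `W ∈ Gr(M, N)` under an
identification of `ℂ^N` with `𝒞(μ)`. -/
def condOf {M N : ℕ} {μ : ℂ →₀ ℕ} (φ : (Fin N → ℂ) ≃ₗ[ℂ] boundedCond μ) (W : Gr M N) :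
    Submodule ℂ Cond :=
  (W.1.map φ.toLinearMap).map (boundedCond μ).subtype

/-- The `Γ₊`-orbit of `W` in `Gr(M, N)`, identified with the Grassmannian of `𝒞(μ)`. -/
def orbit {M N : ℕ} {μ : ℂ →₀ ℕ} (φ : (Fin N → ℂ) ≃ₗ[ℂ] boundedCond μ) (W : Gr M N) :
    Set (Gr M N) :=
  {W' | ∃ g ∈ gammaPlus, condOf φ W' = (condOf φ W).map (act g)}

end DualGr

end

noncomputable section
namespace DualGr

/-! ## The conductor and the units of the coordinate ring -/

/-! Let Z be the operator on ℂ^N ≅ 𝒞(μ) dual to multiplication by z; it is annihilated by m = ∏ (z -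
a)^{μ(a)}. A finite-dimensional space of functionals is determined by its common zeros, so the
spectral ring of the conditions W is A = {p | p(Z) W ⊆ W} (`spectralRing_condOf`). It contains the
ideal (m), and so has a nonzero conductor.

Each g in Γ₊ acts on 𝒞(μ) through the residue of 1/g modulo m. Conversely, every unit modulo m is
congruent to e^p for a polynomial p (`exists_exp_interpolation`), and the scalar e^{p(0)} moves no
subspace. Hence the orbits of Γ₊ are those of (ℂ[z]/m)ˣ (`orbit_eq_translates`). This group is
commutative, so A is constant along an orbit, and the stabilizer of W consists of the units modulo m
that lie in A.

In Jac(X), a denominator can be replaced by its inverse modulo the conductor. Every class is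
therefore that of a polynomial f, and f may be changed within the conductor until it is prime to m.
Two such f have the same class exactly when they differ by a unit in the stabilizer
(`jacMk_eq_iff_of_map_eq`). So [f] ↦ f(Z)⁻¹ W is a bijection from Jac(X) onto the orbit.

It is regular by Cramer's rule (`isMorphism_jac_gr`). For the inverse, f is a solution of the linear
system f(Z) Y ⊆ W; the dimension of its solution space is constant along the orbit, so solutions
extend rationally (`exists_rational_kernel`, `isMorphism_gr_jac`). -/

/-- The conductor `{p | p ℂ[z] ⊆ A}` as an ideal of `ℂ[z]`. -/
def conductor (A : Subalgebra ℂ ℂ[X]) : Ideal ℂ[X] where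
  carrier := {p | ∀ f : ℂ[X], p * f ∈ A}
  zero_mem' := fun f => by rw [zero_mul]; exact A.zero_mem
  add_mem' := fun {p q} hp hq f => by rw [add_mul]; exact A.add_mem (hp f) (hq f)
  smul_mem' := fun c p hp f => by
    rw [smul_eq_mul, mul_comm c p, mul_assoc]; exact hp _

theorem mem_of_mem_conductor {A : Subalgebra ℂ ℂ[X]} {p : ℂ[X]} (hp : p ∈ conductor A) :
    p ∈ A := by
  simpa using hp 1

/-- A generator of the conductor vanishes exactly at the points over singular points. -/
theorem exists_conductor_generator {A : Subalgebra ℂ ℂ[X]} {m : ℂ[X]} (hm : m ≠ 0)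
    (hmA : m ∈ conductor A) :
    ∃ k ∈ conductor A, k ≠ 0 ∧ ∀ a, a ∈ singSet A ↔ k.eval a = 0 := by
  obtain ⟨k, hk⟩ := (IsPrincipalIdealRing.principal (conductor A)).principal
  have hkA : k ∈ conductor A := by rw [hk]; exact Submodule.mem_span_singleton_self k
  refine ⟨k, hkA, ?_, fun a => ⟨fun h => h k hkA, fun h p hp => ?_⟩⟩
  · rintro rfl
    rw [hk] at hmA
    simp at hmA
    exact hm hmA
  · have hp' : p ∈ conductor A := hp
    rw [hk] at hp'
    obtain ⟨c, rfl⟩ := Submodule.mem_span_singleton.mp hp'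
    simp [h]

/-- Elements of `A` without zeros over the singular points are invertible modulo the conductor. -/
theorem mem_of_mul_mem {A : Subalgebra ℂ ℂ[X]} {m q x : ℂ[X]} (hm : m ≠ 0)
    (hmA : m ∈ conductor A) (hq : q ∈ A) (hq0 : ∀ a ∈ singSet A, q.eval a ≠ 0)
    (hx : x * q ∈ A) : x ∈ A := by
  obtain ⟨k, hkA, hk0, hk⟩ := exists_conductor_generator hm hmA
  -- The factors q - q(a) can be stripped one at a time: if y q and y (q - q(a)) lie in A, so does
  -- q(a) y, and q(a) ≠ 0. The full product over the roots of k is divisible by k, which starts the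
  -- process.
  have key : ∀ s : Multiset ℂ, (∀ a ∈ s, q.eval a ≠ 0) → ∀ y : ℂ[X], y * q ∈ A →
      y * (s.map fun a => q - C (q.eval a)).prod ∈ A → y ∈ A := by
    intro s
    induction s using Multiset.induction_on with
    | empty => intro _ y _ h; simpa using h
    | cons a s ih =>
      intro hs y hy h
      have hC : ∀ c : ℂ, C c ∈ A := fun c => A.algebraMap_mem c
      rw [Multiset.map_cons, Multiset.prod_cons, ← mul_assoc] at h
      have h1 : y * (q - C (q.eval a)) ∈ A := by
        refine ih (fun b hb => hs b (Multiset.mem_cons_of_mem hb)) _ ?_ h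
        have : y * (q - C (q.eval a)) * q = (y * q) * (q - C (q.eval a)) := by ring
        rw [this]
        exact A.mul_mem hy (A.sub_mem hq (hC _))
      have h2 : y * C (q.eval a) ∈ A := by
        have : y * C (q.eval a) = y * q - y * (q - C (q.eval a)) := by ring
        rw [this]
        exact A.sub_mem hy h1
      have h3 : y = y * C (q.eval a) * C (q.eval a)⁻¹ := by
        rw [mul_assoc, ← C_mul, mul_inv_cancel₀ (hs a (Multiset.mem_cons_self a s)), C_1, mul_one]
      rw [h3]
      exact A.mul_mem h2 (hC _)
  have hroots : ∀ a ∈ k.roots, a ∈ singSet A := fun a ha => (hk a).mpr (isRoot_of_mem_roots ha)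
  refine key k.roots (fun a ha => hq0 a (hroots a ha)) x hx ?_
  have hdvd : (k.roots.map fun a => X - C a).prod ∣
      (k.roots.map fun a => q - C (q.eval a)).prod :=
    Multiset.prod_dvd_prod_of_dvd _ _ fun a _ => X_sub_C_dvd_sub_C_eval
  have hk' := (IsAlgClosed.splits k).eq_prod_roots
  have hdvd' : k ∣ (k.roots.map fun a => q - C (q.eval a)).prod := by
    refine (dvd_of_eq hk').trans ?_
    exact (associated_unit_mul_left _ _
      (isUnit_C.mpr (isUnit_iff_ne_zero.mpr (leadingCoeff_ne_zero.mpr hk0)))).dvd.trans hdvd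
  obtain ⟨c, hc⟩ := hdvd'
  rw [hc, mul_left_comm]
  exact hkA _

theorem isCoprime_iff_eval_ne_zero {f m : ℂ[X]} :
    IsCoprime f m ↔ ∀ a, m.eval a = 0 → f.eval a ≠ 0 := by
  rw [Polynomial.isCoprime_iff_aeval_ne_zero_of_isAlgClosed ℂ ℂ]
  refine forall_congr' fun a => ?_
  simp only [coe_aeval_eq_eval]
  tauto

/-- The inverse of f modulo the conductor comes from Bézout. Nonvanishing of g is required because
only nonzero polynomials have divisors. -/
theorem exists_mul_sub_one_mem_conductor {A : Subalgebra ℂ ℂ[X]} {m f : ℂ[X]} (hm : m ≠ 0)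
    (hmA : m ∈ conductor A) (hf : ∀ a ∈ singSet A, f.eval a ≠ 0) :
    ∃ g : ℂ[X], g ≠ 0 ∧ f * g - 1 ∈ conductor A := by
  obtain ⟨k, hkA, hk0, hk⟩ := exists_conductor_generator hm hmA
  obtain ⟨u, v, h⟩ : IsCoprime f k :=
    isCoprime_iff_eval_ne_zero.mpr fun a ha => hf a ((hk a).mpr ha)
  have key : ∀ c : ℂ[X], f * (u + c * k) - 1 ∈ conductor A := fun c => by
    have : f * (u + c * k) - 1 = (f * c - v) * k := by rw [← h]; ring
    rw [this]
    exact Ideal.mul_mem_left _ _ hkA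
  -- The coefficient u can vanish only if k is a unit; adding k then gives a nonzero choice.
  by_cases hu : u = 0
  · exact ⟨k, hk0, by simpa [hu] using key 1⟩
  · exact ⟨u, hu, by simpa using key 0⟩

theorem eval_ne_zero_of_sub_one_mem_conductor {A : Subalgebra ℂ ℂ[X]} {f : ℂ[X]}
    (hf : f - 1 ∈ conductor A) {a : ℂ} (ha : a ∈ singSet A) : f.eval a ≠ 0 := by
  have h := ha _ hf
  intro h0
  simp [h0] at h

theorem isUnitAtSing_of_sub_one_mem_conductor {A : Subalgebra ℂ ℂ[X]} {f : ℂ[X]} (hf0 : f ≠ 0)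
    (hf : f - 1 ∈ conductor A) : IsUnitAtSing A f := by
  refine ⟨?_, hf0, fun a ha => eval_ne_zero_of_sub_one_mem_conductor hf ha⟩
  have : f = (f - 1) + 1 := by ring
  rw [this]
  exact A.add_mem (mem_of_mem_conductor hf) A.one_mem

/-! ## Classes of polynomials in the generalized Jacobian -/

/-- The class of the divisor of a polynomial without zeros over the singular points. -/
def jacMk (A : Subalgebra ℂ ℂ[X]) (f : ℂ[X]) (hf : ∀ a ∈ singSet A, f.eval a ≠ 0) : Jac A :=
  QuotientAddGroup.mk ⟨polyDiv f, polyDiv_mem A hf⟩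

theorem polyDiv_apply_coe (f : ℂ[X]) (a : ℂ) :
    polyDiv f (a : OnePoint ℂ) = f.rootMultiplicity a := by
  classical
  have key : ∀ s : Multiset ℂ,
      (s.map fun b : ℂ => Finsupp.single (b : OnePoint ℂ) (1 : ℤ)).sum (a : OnePoint ℂ)
        = s.count a := by
    intro s
    induction s using Multiset.induction_on with
    | empty => simp
    | cons b s ih =>
      rw [Multiset.map_cons, Multiset.sum_cons, Finsupp.add_apply, ih, Multiset.count_cons,
        Finsupp.single_apply]
      by_cases h : a = b
      · subst h; simp; ring
      · have : (b : OnePoint ℂ) ≠ a := fun h' => h (OnePoint.coe_injective h').symm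
        simp [h, this]
  unfold polyDiv
  rw [Finsupp.sub_apply, key, Finsupp.single_apply, if_neg (OnePoint.infty_ne_coe a), sub_zero,
    count_roots]

theorem exists_eq_C_mul_of_polyDiv_eq {f g : ℂ[X]} (hf : f ≠ 0) (hg : g ≠ 0)
    (h : polyDiv f = polyDiv g) : ∃ c : ℂ, c ≠ 0 ∧ f = C c * g := by
  have hr : f.roots = g.roots := by
    classical
    ext a
    have := DFunLike.congr_fun h (a : OnePoint ℂ)
    rw [polyDiv_apply_coe, polyDiv_apply_coe] at this
    rw [count_roots, count_roots]
    exact_mod_cast this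
  have hg' : g.leadingCoeff ≠ 0 := by simpa
  refine ⟨f.leadingCoeff / g.leadingCoeff, div_ne_zero (by simpa) hg', ?_⟩
  calc f = C f.leadingCoeff * (g.roots.map fun a => X - C a).prod := by
        rw [← hr]; exact (IsAlgClosed.splits f).eq_prod_roots
    _ = C (f.leadingCoeff / g.leadingCoeff) *
        (C g.leadingCoeff * (g.roots.map fun a => X - C a).prod) := by
        rw [← mul_assoc, ← C_mul, div_mul_cancel₀ _ hg']
    _ = _ := by rw [← (IsAlgClosed.splits g).eq_prod_roots]

theorem jacMk_mul {A : Subalgebra ℂ ℂ[X]} {f g : ℂ[X]} (hf : ∀ a ∈ singSet A, f.eval a ≠ 0)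
    (hg : ∀ a ∈ singSet A, g.eval a ≠ 0) (hf0 : f ≠ 0) (hg0 : g ≠ 0)
    (hfg : ∀ a ∈ singSet A, (f * g).eval a ≠ 0) :
    jacMk A (f * g) hfg = jacMk A f hf + jacMk A g hg := by
  unfold jacMk
  rw [← QuotientAddGroup.mk_add]
  congr 1
  exact Subtype.ext (polyDiv_mul hf0 hg0)

/-- A polynomial is determined by its divisor up to a nonzero constant, and constants are units of
A. -/
theorem jacMk_eq_iff {A : Subalgebra ℂ ℂ[X]} {f g : ℂ[X]} {hf : ∀ a ∈ singSet A, f.eval a ≠ 0}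
    {hg : ∀ a ∈ singSet A, g.eval a ≠ 0} (hf0 : f ≠ 0) (hg0 : g ≠ 0) :
    jacMk A f hf = jacMk A g hg ↔
      ∃ p q, IsUnitAtSing A p ∧ IsUnitAtSing A q ∧ f * q = g * p := by
  unfold jacMk
  rw [QuotientAddGroup.eq, AddSubgroup.mem_addSubgroupOf]
  constructor
  · rintro ⟨p, q, hp, hq, h⟩
    have h' : polyDiv (g * q) = polyDiv (f * p) := by
      rw [polyDiv_mul hg0 hq.2.1, polyDiv_mul hf0 hp.2.1]
      have h2 : -polyDiv f + polyDiv g = polyDiv p - polyDiv q := h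
      have : polyDiv g + polyDiv q = polyDiv f + (-polyDiv f + polyDiv g) + polyDiv q := by abel
      rw [this, h2]; abel
    obtain ⟨c, hc, he⟩ := exists_eq_C_mul_of_polyDiv_eq (mul_ne_zero hg0 hq.2.1)
      (mul_ne_zero hf0 hp.2.1) h'
    have hcU : IsUnitAtSing A (C c) := ⟨A.algebraMap_mem c, by simpa using hc, by simpa using
      fun _ _ => hc⟩
    exact ⟨q, C c * p, hq, hcU.mul hp, by rw [he]; ring⟩
  · rintro ⟨p, q, hp, hq, h⟩
    refine ⟨q, p, hq, hp, ?_⟩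
    have h' : polyDiv f + polyDiv q = polyDiv g + polyDiv p := by
      rw [← polyDiv_mul hf0 hq.2.1, ← polyDiv_mul hg0 hp.2.1, h]
    have : -polyDiv f + polyDiv g = polyDiv q - polyDiv p := by
      have e : polyDiv f = polyDiv g + polyDiv p - polyDiv q := by rw [← h']; abel
      rw [e]; abel
    exact this

/-- Adding an element of the conductor does not change the class. -/
theorem jacMk_eq_of_sub_mem_conductor {A : Subalgebra ℂ ℂ[X]} {m f g : ℂ[X]} (hm : m ≠ 0)
    (hmA : m ∈ conductor A) {hf : ∀ a ∈ singSet A, f.eval a ≠ 0}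
    {hg : ∀ a ∈ singSet A, g.eval a ≠ 0} (hf0 : f ≠ 0) (hg0 : g ≠ 0)
    (h : f - g ∈ conductor A) : jacMk A f hf = jacMk A g hg := by
  -- One u inverts both f and g modulo the conductor, so f/g = (f u)/(g u) is a quotient of two
  -- units.
  obtain ⟨u, hu0, hu⟩ := exists_mul_sub_one_mem_conductor hm hmA hf
  have hu' : g * u - 1 ∈ conductor A := by
    have : g * u - 1 = (f * u - 1) - u * (f - g) := by ring
    rw [this]
    exact Ideal.sub_mem _ hu (Ideal.mul_mem_left _ _ h)
  exact (jacMk_eq_iff hf0 hg0).mpr ⟨f * u, g * u,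
    isUnitAtSing_of_sub_one_mem_conductor (mul_ne_zero hf0 hu0) hu,
    isUnitAtSing_of_sub_one_mem_conductor (mul_ne_zero hg0 hu0) hu', by ring⟩

theorem polyDiv_X_sub_C_pow (a : ℂ) (n : ℕ) :
    polyDiv ((X - C a) ^ n) =
      Finsupp.single (a : OnePoint ℂ) (n : ℤ) - Finsupp.single OnePoint.infty (n : ℤ) := by
  unfold polyDiv
  rw [roots_pow, roots_X_sub_C, Multiset.map_nsmul, Multiset.sum_nsmul]
  simp

/-- The multiple of ∞ makes an induction over the support possible, since partial sums of a divisor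
of degree 0 need not have degree 0. -/
theorem exists_polyDiv_eq_add {A : Subalgebra ℂ ℂ[X]} (D : OnePoint ℂ →₀ ℤ)
    (hD : ∀ a ∈ singSet A, D (a : OnePoint ℂ) = 0) :
    ∃ p q : ℂ[X], p ≠ 0 ∧ q ≠ 0 ∧ (∀ a ∈ singSet A, p.eval a ≠ 0) ∧
      (∀ a ∈ singSet A, q.eval a ≠ 0) ∧
      ∃ n : ℤ, D = polyDiv p - polyDiv q + Finsupp.single OnePoint.infty n := by
  induction D using Finsupp.induction with
  | zero => exact ⟨1, 1, one_ne_zero, one_ne_zero, by simp, by simp, 0, by simp⟩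
  | single_add x b f hx hb ih =>
    have hxs : ∀ a ∈ singSet A, (a : OnePoint ℂ) ≠ x := by
      rintro a ha rfl
      have := hD a ha
      rw [Finsupp.add_apply, Finsupp.single_eq_same, Finsupp.notMem_support_iff.mp hx] at this
      simp at this
      exact hb this
    obtain ⟨p, q, hp0, hq0, hp, hq, n, h⟩ := ih fun a ha => by
      have := hD a ha
      rwa [Finsupp.add_apply, Finsupp.single_eq_of_ne (hxs a ha), zero_add] at this
    induction x using OnePoint.rec with
    | infty =>
      exact ⟨p, q, hp0, hq0, hp, hq, b + n, by rw [h, Finsupp.single_add]; abel⟩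
    | coe x =>
      have hxa : ∀ k : ℕ, ∀ a ∈ singSet A, ((X - C x) ^ k).eval a ≠ 0 := fun k a ha => by
        rw [eval_pow, eval_sub, eval_X, eval_C]
        exact pow_ne_zero _ (sub_ne_zero.mpr fun e => hxs a ha (by rw [e]))
      have hx0 : ∀ k : ℕ, (X - C x) ^ k ≠ 0 := fun k => pow_ne_zero _ (X_sub_C_ne_zero x)
      obtain ⟨k, rfl | rfl⟩ := b.eq_nat_or_neg
      · refine ⟨p * (X - C x) ^ k, q, mul_ne_zero hp0 (hx0 k), hq0, fun a ha => ?_, hq, k + n, ?_⟩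
        · rw [eval_mul]; exact mul_ne_zero (hp a ha) (hxa k a ha)
        · rw [h, polyDiv_mul hp0 (hx0 k), polyDiv_X_sub_C_pow, Finsupp.single_add]; abel
      · refine ⟨p, q * (X - C x) ^ k, hp0, mul_ne_zero hq0 (hx0 k), hp, fun a ha => ?_, -k + n, ?_⟩
        · rw [eval_mul]; exact mul_ne_zero (hq a ha) (hxa k a ha)
        · rw [h, polyDiv_mul hq0 (hx0 k), polyDiv_X_sub_C_pow, Finsupp.single_add,
            Finsupp.single_neg, Finsupp.single_neg]
          abel

theorem exists_polyDiv_eq {A : Subalgebra ℂ ℂ[X]} {D : OnePoint ℂ →₀ ℤ} (hD : D ∈ divZero A) :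
    ∃ p q : ℂ[X], p ≠ 0 ∧ q ≠ 0 ∧ (∀ a ∈ singSet A, p.eval a ≠ 0) ∧
      (∀ a ∈ singSet A, q.eval a ≠ 0) ∧ D = polyDiv p - polyDiv q := by
  obtain ⟨p, q, hp0, hq0, hp, hq, n, h⟩ := exists_polyDiv_eq_add D hD.2
  have h0 := hD.1
  rw [h, map_add, map_sub, (polyDiv_mem A hp).1, (polyDiv_mem A hq).1, Finsupp.degree_single,
    sub_zero, zero_add] at h0
  exact ⟨p, q, hp0, hq0, hp, hq, by rw [h, h0]; simp⟩

/-- Every class in the generalized Jacobian is represented by a polynomial. -/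
theorem exists_eq_jacMk {A : Subalgebra ℂ ℂ[X]} {m : ℂ[X]} (hm : m ≠ 0)
    (hmA : m ∈ conductor A) (j : Jac A) :
    ∃ (f : ℂ[X]) (hf : ∀ a ∈ singSet A, f.eval a ≠ 0), f ≠ 0 ∧ j = jacMk A f hf := by
  induction j using QuotientAddGroup.induction_on with
  | H D =>
    obtain ⟨D, hD⟩ := D
    obtain ⟨p, q, hp0, hq0, hp, hq, h⟩ := exists_polyDiv_eq hD
    -- The class of p/q equals that of p u, where u inverts q modulo the conductor.
    obtain ⟨u, hu0, hu⟩ := exists_mul_sub_one_mem_conductor hm hmA hq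
    have hquA := isUnitAtSing_of_sub_one_mem_conductor (mul_ne_zero hq0 hu0) hu
    have hua : ∀ a ∈ singSet A, u.eval a ≠ 0 := fun a ha => by
      have := hquA.2.2 a ha
      rw [eval_mul] at this
      exact right_ne_zero_of_mul this
    refine ⟨p * u, fun a ha => ?_, mul_ne_zero hp0 hu0, ?_⟩
    · rw [eval_mul]; exact mul_ne_zero (hp a ha) (hua a ha)
    · unfold jacMk
      rw [QuotientAddGroup.eq, AddSubgroup.mem_addSubgroupOf]
      refine ⟨q * u, 1, hquA, ⟨A.one_mem, one_ne_zero, by simp⟩, ?_⟩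
      have h1 : polyDiv 1 = 0 := by simp [polyDiv]
      have : -D + polyDiv (p * u) = polyDiv (q * u) - polyDiv 1 := by
        rw [h, polyDiv_mul hp0 hu0, polyDiv_mul hq0 hu0, h1]; abel
      exact this

/-- A shift by a constant multiple of `k` removes the zeros of `f` outside those of `k`. -/
theorem exists_isCoprime_add_C_mul {f k m : ℂ[X]} (hm : m ≠ 0)
    (hf : ∀ a, k.eval a = 0 → f.eval a ≠ 0) : ∃ c : ℂ, IsCoprime (f + C c * k) m := by
  -- Only finitely many c are bad, namely -f(a)/k(a) at the roots a of m. A root with k(a) = 0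
  -- contributes the value 0, whose exclusion is harmless.
  obtain ⟨c, hc⟩ := Set.Infinite.nonempty (Set.Finite.infinite_compl
    ((m.roots.toFinset.image fun a => -(f.eval a) / k.eval a).finite_toSet))
  refine ⟨c, isCoprime_iff_eval_ne_zero.mpr fun a ha h => hc ?_⟩
  rw [eval_add, eval_mul, eval_C] at h
  by_cases hk : k.eval a = 0
  · exact absurd (by simpa [hk] using h) (hf a hk)
  · simp only [Finset.coe_image, Set.mem_image]
    refine ⟨a, by simp [hm, ha], ?_⟩
    rw [div_eq_iff hk]
    linear_combination -h

/-! ## Orbits of subspaces under the units of a polynomial algebra of endomorphisms -/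

section Stabilizer

variable {E : Type*} [AddCommGroup E] [Module ℂ E] (Z : Module.End ℂ E)

/-- The polynomials `p` such that `p(Z)` maps `W` to itself. -/
def stab (W : Submodule ℂ E) : Subalgebra ℂ ℂ[X] where
  carrier := {p | ∀ w ∈ W, aeval Z p w ∈ W}
  mul_mem' := by
    intro p q hp hq w hw
    rw [map_mul]
    exact hp _ (hq _ hw)
  add_mem' := by
    intro p q hp hq w hw
    rw [map_add]
    exact W.add_mem (hp _ hw) (hq _ hw)
  algebraMap_mem' := by
    intro a w hw
    rw [AlgHom.commutes, Module.algebraMap_end_apply]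
    exact W.smul_mem a hw

variable {Z}

theorem mem_stab {W : Submodule ℂ E} {p : ℂ[X]} :
    p ∈ stab Z W ↔ ∀ w ∈ W, aeval Z p w ∈ W := Iff.rfl

theorem mem_stab_iff_map_le {W : Submodule ℂ E} {p : ℂ[X]} :
    p ∈ stab Z W ↔ W.map (aeval Z p) ≤ W := by
  rw [Submodule.map_le_iff_le_comap]; rfl

theorem map_aeval_mul (W : Submodule ℂ E) (f g : ℂ[X]) :
    W.map (aeval Z (f * g)) = (W.map (aeval Z g)).map (aeval Z f) := by
  rw [map_mul, Module.End.mul_eq_comp, Submodule.map_comp]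

variable {m : ℂ[X]} (hZ : aeval Z m = 0)
include hZ

theorem aeval_eq_of_dvd_sub {f g : ℂ[X]} (h : m ∣ f - g) : aeval Z f = aeval Z g := by
  obtain ⟨c, hc⟩ := h
  rw [← sub_eq_zero, ← map_sub, hc, map_mul, hZ, zero_mul]

theorem mem_conductor_stab (W : Submodule ℂ E) : m ∈ conductor (stab Z W) := by
  intro f w _
  rw [map_mul, hZ, zero_mul]
  exact W.zero_mem

theorem eval_eq_zero_of_mem_singSet {W : Submodule ℂ E} {a : ℂ} (ha : a ∈ singSet (stab Z W)) :
    m.eval a = 0 :=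
  ha m (mem_conductor_stab hZ W)

theorem eval_ne_zero_of_isCoprime {f : ℂ[X]} (hf : IsCoprime f m)
    (W : Submodule ℂ E) : ∀ a ∈ singSet (stab Z W), f.eval a ≠ 0 :=
  fun a ha => isCoprime_iff_eval_ne_zero.mp hf a (eval_eq_zero_of_mem_singSet hZ ha)

theorem exists_aeval_inverse {f : ℂ[X]} (hf : IsCoprime f m) :
    ∃ g, IsCoprime g m ∧ aeval Z (f * g) = 1 ∧ aeval Z (g * f) = 1 := by
  obtain ⟨u, v, h⟩ := hf
  have h1 : aeval Z (u * f) = 1 := by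
    have := congrArg (fun p : ℂ[X] => aeval Z p) h
    simpa only [map_add, map_mul _ v, hZ, mul_zero, add_zero, map_one] using this
  exact ⟨u, ⟨f, v, by rw [← h]; ring⟩, by rw [mul_comm f u, h1], h1⟩

theorem injective_aeval {f : ℂ[X]} (hf : IsCoprime f m) : Function.Injective (aeval Z f) := by
  obtain ⟨g, -, -, h⟩ := exists_aeval_inverse hZ hf
  intro x y hxy
  have := congrArg (aeval Z g) hxy
  rwa [← Module.End.mul_apply, ← Module.End.mul_apply, ← map_mul, h] at this

theorem exists_map_aeval_eq (W : Submodule ℂ E) {f : ℂ[X]} (hf : IsCoprime f m) :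
    ∃ W' : Submodule ℂ E, W'.map (aeval Z f) = W := by
  obtain ⟨g, -, h, -⟩ := exists_aeval_inverse hZ hf
  refine ⟨W.map (aeval Z g), ?_⟩
  rw [← map_aeval_mul, h]
  exact Submodule.map_id W

theorem map_aeval_injective {f : ℂ[X]} (hf : IsCoprime f m) :
    Function.Injective (Submodule.map (aeval Z f) : Submodule ℂ E → Submodule ℂ E) :=
  Submodule.map_injective_of_injective (injective_aeval hZ hf)

theorem finrank_map_aeval (W : Submodule ℂ E) {f : ℂ[X]} (hf : IsCoprime f m) :
    Module.finrank ℂ (W.map (aeval Z f)) = Module.finrank ℂ W :=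
  (Submodule.equivMapOfInjective _ (injective_aeval hZ hf) W).symm.finrank_eq

/-- f(Z) is injective and commutes with every p(Z). This makes the spectral curve constant along
orbits. -/
theorem stab_eq_of_map_eq {W W' : Submodule ℂ E} {f : ℂ[X]} (hf : IsCoprime f m)
    (h : W'.map (aeval Z f) = W) : stab Z W' = stab Z W := by
  ext p
  rw [mem_stab_iff_map_le, mem_stab_iff_map_le, ← h, ← map_aeval_mul, mul_comm, map_aeval_mul,
    Submodule.map_le_map_iff_of_injective (injective_aeval hZ hf)]

theorem map_aeval_eq_of_mem_stab [FiniteDimensional ℂ E] {W : Submodule ℂ E} {p : ℂ[X]}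
    (hp : IsCoprime p m) (h : p ∈ stab Z W) : W.map (aeval Z p) = W :=
  Submodule.eq_of_le_of_finrank_eq (mem_stab_iff_map_le.mp h) (finrank_map_aeval hZ W hp)

/-- Two units give the same point of the orbit if and only if their divisors have the same class
in the generalized Jacobian. -/
theorem jacMk_eq_iff_of_map_eq [FiniteDimensional ℂ E] (hm : m ≠ 0) {W W₁ W₂ : Submodule ℂ E}
    {f₁ f₂ : ℂ[X]} (hf₁ : IsCoprime f₁ m) (hf₂ : IsCoprime f₂ m) (hf₁0 : f₁ ≠ 0) (hf₂0 : f₂ ≠ 0)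
    (h₁ : W₁.map (aeval Z f₁) = W) (h₂ : W₂.map (aeval Z f₂) = W) :
    jacMk (stab Z W) f₁ (eval_ne_zero_of_isCoprime hZ hf₁ W) =
      jacMk (stab Z W) f₂ (eval_ne_zero_of_isCoprime hZ hf₂ W) ↔ W₁ = W₂ := by
  obtain ⟨g, hg, hfg, hgf⟩ := exists_aeval_inverse hZ hf₂
  have hmA := mem_conductor_stab hZ W
  rw [jacMk_eq_iff hf₁0 hf₂0]
  constructor
  · rintro ⟨p, q, hp, hq, h⟩
    -- Here g inverts f₂ on E. Thus f₁ g q acts as p, and q can be cancelled because it is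
    -- invertible modulo the conductor.
    have hx : f₁ * g ∈ stab Z W := by
      refine mem_of_mul_mem hm hmA hq.1 hq.2.2 ?_
      have e : f₁ * g * q = (f₂ * g) * p := by rw [mul_right_comm, h]; ring
      rw [mem_stab, e, map_mul, hfg, one_mul]
      exact mem_stab.mp hp.1
    have hW := map_aeval_eq_of_mem_stab hZ (hf₁.mul_left hg) hx
    have hW₂ : W₂ = W.map (aeval Z g) := by
      rw [← h₂, ← map_aeval_mul, hgf]
      exact (Submodule.map_id W₂).symm
    refine map_aeval_injective hZ hf₁ ?_
    rw [hW₂, ← map_aeval_mul, hW, h₁]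
  · rintro rfl
    have key : ∀ f : ℂ[X], f ≠ 0 → IsCoprime f m → W₁.map (aeval Z f) = W →
        g ≠ 0 → IsUnitAtSing (stab Z W) (f * g) := by
      intro f hf0 hf h hg0
      refine ⟨?_, mul_ne_zero hf0 hg0, eval_ne_zero_of_isCoprime hZ (hf.mul_left hg) W⟩
      rw [mem_stab_iff_map_le, map_aeval_mul, ← h₂, ← map_aeval_mul W₁ g, hgf]
      exact le_of_eq ((congrArg _ (Submodule.map_id W₁)).trans (h.trans h₂.symm))
    -- If g = 0, then 1 = 0 in End E. The stabilizer is then all of ℂ[z] and there are no singular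
    -- points.
    by_cases hg0 : g = 0
    · have h10 : (1 : Module.End ℂ E) = 0 := by rw [← hfg, hg0, mul_zero, map_zero]
      have : ∀ p, p ∈ stab Z W := fun p w _ => by
        have : (aeval Z p) w = 0 := by
          rw [← one_mul (aeval Z p), h10, zero_mul, LinearMap.zero_apply]
        rw [this]; exact W.zero_mem
      have hs : ∀ a, a ∉ singSet (stab Z W) := fun a ha => by
        simpa using ha 1 fun f => this _
      exact ⟨f₁, f₂, ⟨this _, hf₁0, fun a ha => absurd ha (hs a)⟩,
        ⟨this _, hf₂0, fun a ha => absurd ha (hs a)⟩, mul_comm _ _⟩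
    · exact ⟨f₁ * g, f₂ * g, key f₁ hf₁0 hf₁ h₁ hg0, key f₂ hf₂0 hf₂ h₂ hg0, by ring⟩

end Stabilizer

/-- When m is a nonzero constant, 0 is prime to m. The extra factor X rules this out. -/
theorem ne_zero_of_isCoprime_mul_X {f m : ℂ[X]} (h : IsCoprime f (m * X)) : f ≠ 0 := by
  rintro rfl
  exact isCoprime_iff_eval_ne_zero.mp h 0 (by simp) (by simp)

section Translates

variable {M N : ℕ} {Z : Module.End ℂ (Fin N → ℂ)} {m : ℂ[X]}

/-- The orbit of `W` under the operators `f(Z)` with `f` prime to `m`. -/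
def translates (Z : Module.End ℂ (Fin N → ℂ)) (m : ℂ[X]) (W : Gr M N) : Set (Gr M N) :=
  {W' | ∃ f : ℂ[X], f ≠ 0 ∧ IsCoprime f m ∧ W'.1.map (aeval Z f) = W.1}

/-- The class of a unit `f` in the generalized Jacobian corresponds to `f(Z)⁻¹ W`. -/
theorem exists_jac_equiv_translates (hm : m ≠ 0) (hZ : aeval Z m = 0) (W : Gr M N) :
    ∃ Φ : Jac (stab Z W.1) ≃ translates Z m W, ∀ (f : ℂ[X]) (_ : f ≠ 0) (_ : IsCoprime f m)
      (h : ∀ a ∈ singSet (stab Z W.1), f.eval a ≠ 0),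
      (Φ (jacMk _ f h)).1.1.map (aeval Z f) = W.1 := by
  have hmA := mem_conductor_stab hZ W.1
  choose f hf0 hf hfW using fun W' : translates Z m W => W'.2
  -- The class does not depend on the chosen unit, by `jacMk_eq_iff_of_map_eq`.
  let F : translates Z m W → Jac (stab Z W.1) := fun W' =>
    jacMk _ (f W') (eval_ne_zero_of_isCoprime hZ (hf W') W.1)
  have hFinj : Function.Injective F := fun W₁ W₂ h => Subtype.ext <| Subtype.ext <|
    (jacMk_eq_iff_of_map_eq hZ hm (hf W₁) (hf W₂) (hf0 W₁) (hf0 W₂) (hfW W₁) (hfW W₂)).mp h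
  have hF : ∀ g : ℂ[X], g ≠ 0 → IsCoprime g m → ∀ h, ∃ W' : translates Z m W,
      W'.1.1.map (aeval Z g) = W.1 ∧ F W' = jacMk _ g h := by
    intro g hg0 hg h
    obtain ⟨W', hW'⟩ := exists_map_aeval_eq hZ W.1 hg
    have hr : Module.finrank ℂ W' = M := by
      rw [← finrank_map_aeval hZ W' hg, hW']; exact W.2
    exact ⟨⟨⟨W', hr⟩, g, hg0, hg, hW'⟩, hW', (jacMk_eq_iff_of_map_eq hZ hm (hf _) hg (hf0 _) hg0
      (hfW ⟨⟨W', hr⟩, g, hg0, hg, hW'⟩) hW').mpr rfl⟩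
  have hFsurj : Function.Surjective F := by
    intro j
    obtain ⟨p, hp, hp0, rfl⟩ := exists_eq_jacMk hm hmA j
    obtain ⟨k, hkA, hk0, hk⟩ := exists_conductor_generator hm hmA
    -- The representative p is nonzero only over singular points and may still share roots with m; a
    -- shift by c k repairs this within its class.
    obtain ⟨c, hc⟩ := exists_isCoprime_add_C_mul (mul_ne_zero hm X_ne_zero)
      fun a ha => hp a ((hk a).mpr ha)
    have hc0 := ne_zero_of_isCoprime_mul_X hc
    have hc' := hc.of_mul_right_left
    obtain ⟨W', -, hW'⟩ := hF _ hc0 hc' (eval_ne_zero_of_isCoprime hZ hc' W.1)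
    refine ⟨W', hW'.trans (jacMk_eq_of_sub_mem_conductor hm hmA hc0 hp0 ?_)⟩
    rw [add_sub_cancel_left]
    exact Ideal.mul_mem_left _ _ hkA
  refine ⟨(Equiv.ofBijective F ⟨hFinj, hFsurj⟩).symm, fun g hg0 hg h => ?_⟩
  obtain ⟨W', hW', hFW⟩ := hF g hg0 hg h
  rw [← hFW]
  have : (Equiv.ofBijective F ⟨hFinj, hFsurj⟩).symm (F W') = W' :=
    (Equiv.ofBijective F ⟨hFinj, hFsurj⟩).symm_apply_apply W'
  rw [this, hW']

end Translates

/-! ## Kernels of polynomial families of linear systems -/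

section ConstantRank

variable {σ ι κ : Type*} [Fintype ι] [Fintype κ] [DecidableEq κ]

theorem map_eval_mulVec {σ ι κ : Type*} [Fintype κ] (L : Matrix ι κ (MvPolynomial σ ℂ))
    (v : κ → MvPolynomial σ ℂ) (x : σ → ℂ) (i : ι) :
    MvPolynomial.eval x (L.mulVec v i) =
      (L.map (MvPolynomial.eval x)).mulVec (fun k => MvPolynomial.eval x (v k)) i := by
  simp [Matrix.mulVec, dotProduct]

theorem map_eval_map_C {σ ι κ : Type*} (L : Matrix ι κ ℂ) (x : σ → ℂ) :
    (L.map (MvPolynomial.C : ℂ → MvPolynomial σ ℂ)).map (MvPolynomial.eval x) = L := by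
  ext i j; simp

/-- A partial inverse of a linear map together with a projection onto its kernel. -/
theorem exists_partial_inverse {V Y : Type*} [AddCommGroup V] [Module ℂ V] [AddCommGroup Y]
    [Module ℂ Y] (f : V →ₗ[ℂ] Y) :
    ∃ (G : Y →ₗ[ℂ] V) (P : V →ₗ[ℂ] V), (∀ v, G (f v) + P v = v) ∧ (∀ v, f (P v) = 0) ∧
      (∀ v, f v = 0 → P v = v) ∧ ∀ y, P (G y) = 0 := by
  obtain ⟨s, hs⟩ := LinearMap.exists_leftInverse_of_injective (LinearMap.ker f).subtype
    (Submodule.ker_subtype _)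
  have hs' : ∀ v, f v = 0 → ((s v : LinearMap.ker f) : V) = v := fun v hv => by
    have := LinearMap.congr_fun hs ⟨v, hv⟩
    simpa using congrArg Subtype.val this
  obtain ⟨t, ht⟩ := LinearMap.exists_leftInverse_of_injective (f.prod s) (by
    rw [LinearMap.ker_eq_bot']
    intro v hv
    have h1 : f v = 0 := congrArg Prod.fst hv
    have h2 : s v = 0 := congrArg Prod.snd hv
    rw [← hs' v h1, h2]; rfl)
  have ht' : ∀ v, t (f v, s v) = v := fun v => LinearMap.congr_fun ht v
  let P : V →ₗ[ℂ] V := (LinearMap.ker f).subtype ∘ₗ s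
  have hP : ∀ v, f (P v) = 0 := fun v => (s v).2
  have hPP : ∀ v, P (P v) = P v := fun v => hs' _ (hP v)
  have ht0 : ∀ v, t (f v, 0) + P v = v := fun v => by
    have h := ht' (P v)
    have h1 : s (P v) = s v := Subtype.ext (hPP v)
    rw [hP, h1] at h
    calc t (f v, 0) + P v = t (f v, 0) + t (0, s v) := by rw [h]
      _ = t (f v, s v) := by rw [← map_add]; simp
      _ = v := ht' v
  -- The factor 1 - P forces P G = 0.
  refine ⟨(LinearMap.id - P) ∘ₗ t ∘ₗ LinearMap.inl ℂ Y (LinearMap.ker f), P, ?_, hP, hs', ?_⟩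
  · intro v
    have h1 : t (f v, 0) = v - P v := eq_sub_of_add_eq (ht0 v)
    simp [h1, hPP]
  · intro y
    simp [hPP]

/-- Near a point, a kernel vector of a polynomial family of linear maps extends to a rational
family of kernel vectors, along the points where the dimension of the kernel does not drop. -/
theorem exists_rational_kernel (L : Matrix ι κ (MvPolynomial σ ℂ)) (x₀ : σ → ℂ) (c₀ : κ → ℂ)
    (h₀ : (L.map (MvPolynomial.eval x₀)).mulVec c₀ = 0) :
    ∃ (r : κ → MvPolynomial σ ℂ) (q : MvPolynomial σ ℂ), MvPolynomial.eval x₀ q = 1 ∧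
      (∀ k, MvPolynomial.eval x₀ (r k) = c₀ k) ∧
      ∀ x, MvPolynomial.eval x q ≠ 0 →
        Module.finrank ℂ (LinearMap.ker (L.map (MvPolynomial.eval x₀)).mulVecLin) ≤
          Module.finrank ℂ (LinearMap.ker (L.map (MvPolynomial.eval x)).mulVecLin) →
        (L.map (MvPolynomial.eval x)).mulVec (fun k => MvPolynomial.eval x (r k)) = 0 := by
  classical
  obtain ⟨g, p, hgp, hp, hp', hpg⟩ :=
    exists_partial_inverse (L.map (MvPolynomial.eval x₀)).mulVecLin
  let g' : Matrix κ ι (MvPolynomial σ ℂ) := (LinearMap.toMatrix' g).map MvPolynomial.C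
  let p' : Matrix κ κ (MvPolynomial σ ℂ) := (LinearMap.toMatrix' p).map MvPolynomial.C
  -- H is the identity at x₀, so det H ≠ 0 defines a neighbourhood on which adj(H) c₀ = det(H) H⁻¹
  -- c₀ is the candidate family.
  let H : Matrix κ κ (MvPolynomial σ ℂ) := g' * L + p'
  have hH : ∀ x, H.map (MvPolynomial.eval x) =
      LinearMap.toMatrix' g * L.map (MvPolynomial.eval x) + LinearMap.toMatrix' p := by
    intro x
    have h1 : g'.map (MvPolynomial.eval x) = LinearMap.toMatrix' g := map_eval_map_C _ x
    have h2 : p'.map (MvPolynomial.eval x) = LinearMap.toMatrix' p := map_eval_map_C _ x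
    rw [Matrix.map_add _ (map_add _), Matrix.map_mul, h1, h2]
  have hHv : ∀ x v, (H.map (MvPolynomial.eval x)).mulVec v =
      g ((L.map (MvPolynomial.eval x)).mulVec v) + p v := by
    intro x v
    rw [hH, Matrix.add_mulVec, ← Matrix.mulVec_mulVec, LinearMap.toMatrix'_mulVec,
      LinearMap.toMatrix'_mulVec]
  have hdet : ∀ x, MvPolynomial.eval x H.det = (H.map (MvPolynomial.eval x)).det := fun x =>
    RingHom.map_det (MvPolynomial.eval x) H
  have hadj : ∀ x, H.adjugate.map (MvPolynomial.eval x) = (H.map (MvPolynomial.eval x)).adjugate :=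
    fun x => RingHom.map_adjugate (MvPolynomial.eval x) H
  have hr : ∀ x, (fun k => MvPolynomial.eval x
      (H.adjugate.mulVec (fun j => MvPolynomial.C (c₀ j)) k)) =
        (H.map (MvPolynomial.eval x)).adjugate.mulVec c₀ := by
    intro x
    ext k
    rw [map_eval_mulVec, hadj]
    simp
  have hH₀ : H.map (MvPolynomial.eval x₀) = 1 := by
    apply Matrix.toLin'.injective
    refine LinearMap.ext fun v => ?_
    rw [Matrix.toLin'_apply, Matrix.toLin'_apply, hHv, Matrix.one_mulVec]
    exact hgp v
  refine ⟨H.adjugate.mulVec (fun j => MvPolynomial.C (c₀ j)), H.det, ?_, ?_, ?_⟩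
  · rw [hdet, hH₀, Matrix.det_one]
  · intro k
    have := congrFun (hr x₀) k
    rw [hH₀, Matrix.adjugate_one, Matrix.one_mulVec] at this
    exact this
  · intro x hx hdim
    rw [hr]
    set v := (H.map (MvPolynomial.eval x)).adjugate.mulVec c₀ with hv
    have hHvv : (H.map (MvPolynomial.eval x)).mulVec v = MvPolynomial.eval x H.det • c₀ := by
      rw [hv, Matrix.mulVec_mulVec, Matrix.mul_adjugate, Matrix.smul_mulVec, Matrix.one_mulVec,
        hdet]
    let Lx := (L.map (MvPolynomial.eval x)).mulVecLin
    have hHinj : ∀ w, (H.map (MvPolynomial.eval x)).mulVec w = 0 → w = 0 := by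
      intro w hw
      refine Matrix.eq_zero_of_mulVec_eq_zero (M := H.map (MvPolynomial.eval x)) ?_ hw
      rwa [← hdet]
    have hle : LinearMap.ker Lx ≤ LinearMap.ker (g ∘ₗ Lx) := by
      intro w hw
      rw [LinearMap.mem_ker] at hw ⊢
      rw [LinearMap.comp_apply, hw, map_zero]
    -- On ker(g L(x)) the injective H(x) agrees with p, whose image lies in ker L(x₀). With the
    -- assumption on dimensions this gives ker(g L(x)) = ker L(x).
    have hdim' : Module.finrank ℂ (LinearMap.ker (g ∘ₗ Lx)) ≤
        Module.finrank ℂ (LinearMap.ker (L.map (MvPolynomial.eval x₀)).mulVecLin) := by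
      have hmem : ∀ w ∈ LinearMap.ker (g ∘ₗ Lx), (H.map (MvPolynomial.eval x)).mulVecLin w ∈
          LinearMap.ker (L.map (MvPolynomial.eval x₀)).mulVecLin := by
        intro w hw
        have hw' : g ((L.map (MvPolynomial.eval x)).mulVec w) = 0 := hw
        rw [LinearMap.mem_ker, Matrix.mulVecLin_apply _ w, hHv, hw', zero_add]
        exact hp w
      refine LinearMap.finrank_le_finrank_of_injective
        (f := (H.map (MvPolynomial.eval x)).mulVecLin.restrict hmem) ?_
      rw [← LinearMap.ker_eq_bot, LinearMap.ker_eq_bot']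
      intro w hw
      exact Subtype.ext (hHinj w (congrArg Subtype.val hw))
    have heq := Submodule.eq_of_le_of_finrank_le hle (hdim'.trans hdim)
    have hvk : v ∈ LinearMap.ker (g ∘ₗ Lx) := by
      rw [LinearMap.mem_ker, LinearMap.comp_apply]
      -- Since H v is a multiple of c₀, it is fixed by p. As p g = 0, applying p to H v = g L v + p
      -- v yields H v = p v, so g L v = 0.
      have h1 := hHv x v
      have h2 := congrArg p h1
      rw [hHvv, map_smul, map_add, hpg, zero_add, hp' c₀ h₀, hp' (p v) (hp v), ← hHvv, h1] at h2
      exact add_eq_right.mp h2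
    rw [← heq] at hvk
    exact hvk

end ConstantRank

/-! ## Regularity of the orbit map and of its inverse -/

section CoeffPoly

/-- The polynomial `∑ aᵢ zⁱ` of degree less than `n`. -/
def coeffPoly (n : ℕ) : (Fin n → ℂ) →ₗ[ℂ] ℂ[X] :=
  (degreeLT ℂ n).subtype ∘ₗ (degreeLTEquiv ℂ n).symm.toLinearMap

theorem coeffPoly_apply {n : ℕ} (a : Fin n → ℂ) :
    coeffPoly n a = ∑ i, C (a i) * X ^ (i : ℕ) := by
  simp only [C_mul_X_pow_eq_monomial]
  rfl

theorem monicPoly_eq {n : ℕ} (a : Fin n → ℂ) : monicPoly a = X ^ n + coeffPoly n a := by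
  rw [coeffPoly_apply]; rfl

theorem degree_coeffPoly_lt {n : ℕ} (a : Fin n → ℂ) : (coeffPoly n a).degree < n :=
  mem_degreeLT.mp ((degreeLTEquiv ℂ n).symm a).2

theorem coeffPoly_injective (n : ℕ) : Function.Injective (coeffPoly n) :=
  Subtype.val_injective.comp (degreeLTEquiv ℂ n).symm.injective

theorem coeffPoly_coeff {n : ℕ} {p : ℂ[X]} (hp : p.degree < n) :
    coeffPoly n (fun i => p.coeff i) = p :=
  congrArg Subtype.val ((degreeLTEquiv ℂ n).symm_apply_apply ⟨p, mem_degreeLT.mpr hp⟩)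

theorem exists_coeffPoly_eq {n : ℕ} {p : ℂ[X]} (hp : p.degree < n) : ∃ a, coeffPoly n a = p :=
  ⟨_, coeffPoly_coeff hp⟩

theorem monicPoly_ne_zero {n : ℕ} (a : Fin n → ℂ) : monicPoly a ≠ 0 := by
  rw [monicPoly_eq]
  exact (monic_X_pow_add (degree_coeffPoly_lt a)).ne_zero

theorem eval_coeffPoly {n : ℕ} (a : Fin n → ℂ) (s : ℂ) :
    (coeffPoly n a).eval s = ∑ i, a i * s ^ (i : ℕ) := by
  simp [coeffPoly_apply, eval_finsetSum]

theorem aeval_coeffPoly {B : Type*} [Ring B] [Algebra ℂ B] {n : ℕ} (a : Fin n → ℂ) (b : B) :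
    aeval b (coeffPoly n a) = ∑ i, a i • b ^ (i : ℕ) := by
  simp [coeffPoly_apply, Algebra.smul_def]

/-- The value at `s` of the polynomial `u + ∑ aᵢ zⁱ` as a polynomial in the `aᵢ`. -/
def evalFamily (u : ℂ[X]) (n : ℕ) (s : ℂ) : MvPolynomial (Fin n) ℂ :=
  MvPolynomial.C (u.eval s) + ∑ i : Fin n, MvPolynomial.X i * MvPolynomial.C (s ^ (i : ℕ))

theorem eval_evalFamily (u : ℂ[X]) {n : ℕ} (s : ℂ) (a : Fin n → ℂ) :
    MvPolynomial.eval a (evalFamily u n s) = (u + coeffPoly n a).eval s := by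
  simp [evalFamily, eval_coeffPoly]

/-- This turns coprimality with m, along a polynomial family, into the nonvanishing of a single
polynomial in the parameters. -/
theorem eval_prod_roots_ne_zero_iff {σ : Type*} {m : ℂ[X]} (hm : m ≠ 0)
    (e : ℂ → MvPolynomial σ ℂ) (x : σ → ℂ) :
    MvPolynomial.eval x (m.roots.map e).prod ≠ 0 ↔
      ∀ s, m.eval s = 0 → MvPolynomial.eval x (e s) ≠ 0 := by
  rw [map_multiset_prod, Ne, Multiset.prod_eq_zero_iff]
  simp [hm]

end CoeffPoly

/-! ### Matrices of f(Z), Cramer's rule and equations of a subspace -/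

section Matrices

variable {N : ℕ}

/-- The matrix of `f(Z)` for `f = u + ∑ aᵢ zⁱ`, with entries that are polynomials in the `aᵢ`. -/
def matrixFamily (Z : Module.End ℂ (Fin N → ℂ)) (u : ℂ[X]) (n : ℕ) :
    Matrix (Fin N) (Fin N) (MvPolynomial (Fin n) ℂ) := fun k l =>
  MvPolynomial.C (LinearMap.toMatrix' (aeval Z u) k l) +
    ∑ i : Fin n, MvPolynomial.X i * MvPolynomial.C (LinearMap.toMatrix' (Z ^ (i : ℕ)) k l)

theorem map_eval_matrixFamily (Z : Module.End ℂ (Fin N → ℂ)) (u : ℂ[X]) {n : ℕ}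
    (a : Fin n → ℂ) : (matrixFamily Z u n).map (MvPolynomial.eval a) =
      LinearMap.toMatrix' (aeval Z (u + coeffPoly n a)) := by
  ext k l
  simp [matrixFamily, aeval_coeffPoly]

theorem span_range_smul_eq {ι E : Type*} [AddCommGroup E] [Module ℂ E] {c : ℂ} (hc : c ≠ 0)
    (w : ι → E) : Submodule.span ℂ (Set.range fun i => c • w i) =
      Submodule.span ℂ (Set.range w) := by
  refine le_antisymm (Submodule.span_le.mpr ?_) (Submodule.span_le.mpr ?_)
  · rintro _ ⟨i, rfl⟩
    exact Submodule.smul_mem _ _ (Submodule.subset_span ⟨i, rfl⟩)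
  · rintro _ ⟨i, rfl⟩
    have := Submodule.smul_mem _ c⁻¹ (Submodule.subset_span (R := ℂ)
      (Set.mem_range_self (f := fun i => c • w i) i))
    simpa [smul_smul, hc] using this

/-- Cramer's rule for the preimage of a subspace. -/
theorem span_adjugate_mulVec {ι : Type*} {T : Module.End ℂ (Fin N → ℂ)}
    (hT : Function.Injective T) {w : ι → Fin N → ℂ} {Y : Submodule ℂ (Fin N → ℂ)}
    (hY : Y.map T = Submodule.span ℂ (Set.range w)) {q : ℂ} (hq : q ≠ 0) :
    Submodule.span ℂ (Set.range fun i k =>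
      (LinearMap.toMatrix' T).adjugate.mulVec (w i) k / q) = Y := by
  have hdet : (LinearMap.toMatrix' T).det ≠ 0 := by
    rw [LinearMap.det_toMatrix']
    exact (LinearMap.isUnit_iff_isUnit_det T |>.mp
      ((Module.End.isUnit_iff T).mpr ⟨hT, LinearMap.injective_iff_surjective.mp hT⟩)).ne_zero
  apply Submodule.map_injective_of_injective hT
  -- The adjugate inverts T up to det T, so each vector is T⁻¹ wᵢ scaled by the common nonzero
  -- factor det T / q.
  rw [hY, Submodule.map_span, ← Set.range_comp, ← span_range_smul_eq (div_ne_zero hdet hq) w]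
  congr 2
  ext1 i
  have : (fun k => (LinearMap.toMatrix' T).adjugate.mulVec (w i) k / q) =
      q⁻¹ • (LinearMap.toMatrix' T).adjugate.mulVec (w i) := by
    ext k; simp [div_eq_inv_mul]
  rw [Function.comp_apply, this, map_smul, ← LinearMap.toMatrix'_mulVec T, Matrix.mulVec_mulVec,
    Matrix.mul_adjugate, Matrix.smul_mulVec, Matrix.one_mulVec, smul_smul, div_eq_inv_mul]

/-- It supplies linear equations for membership in W. -/
theorem exists_end_ker_eq {E : Type*} [AddCommGroup E] [Module ℂ E] (W : Submodule ℂ E) :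
    ∃ P : Module.End ℂ E, LinearMap.ker P = W := by
  obtain ⟨s, hs⟩ := LinearMap.exists_leftInverse_of_injective W.subtype (Submodule.ker_subtype _)
  refine ⟨LinearMap.id - W.subtype ∘ₗ s, ?_⟩
  ext v
  rw [LinearMap.mem_ker, LinearMap.sub_apply, sub_eq_zero]
  constructor
  · intro h
    have h' : v = (s v : E) := h
    rw [h']; exact (s v).2
  · intro hv
    have := LinearMap.congr_fun hs ⟨v, hv⟩
    exact (congrArg Subtype.val this).symm

end Matrices

section Morphisms

variable {M N : ℕ} {Z : Module.End ℂ (Fin N → ℂ)} {m : ℂ[X]}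

/-- Near a given divisor, a fixed c makes f = `monicPoly a'` + c k prime to m, without changing the
class. There Φ is the preimage of W under f(Z), computed by Cramer's rule. -/
theorem isMorphism_jac_gr (hm : m ≠ 0) (hZ : aeval Z m = 0) (W : Gr M N)
    (Φ : Jac (stab Z W.1) → translates Z m W)
    (hΦ : ∀ (f : ℂ[X]) (_ : f ≠ 0) (_ : IsCoprime f m)
      (h : ∀ a ∈ singSet (stab Z W.1), f.eval a ≠ 0),
      (Φ (jacMk _ f h)).1.1.map (aeval Z f) = W.1) :
    IsMorphism (jacStructure (stab Z W.1)) (grStructure (translates Z m W)) Φ := by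
  have hmA := mem_conductor_stab hZ W.1
  obtain ⟨k, hkA, hk0, hk⟩ := exists_conductor_generator hm hmA
  obtain ⟨w, hw⟩ : ∃ w : Fin M → Fin N → ℂ, Submodule.span ℂ (Set.range w) = W.1 := by
    let b := Module.finBasisOfFinrankEq ℂ W.1 W.2
    refine ⟨fun i => b i, ?_⟩
    have := congrArg (Submodule.map W.1.subtype) b.span_eq
    rwa [Submodule.map_span, ← Set.range_comp, Submodule.map_top, Submodule.range_subtype] at this
  have hmX : m * X ≠ 0 := mul_ne_zero hm X_ne_zero
  rintro _ ⟨n, rfl⟩ a j ⟨ha, rfl⟩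
  obtain ⟨c, hc⟩ := exists_isCoprime_add_C_mul (f := monicPoly a) hmX
    fun s hs => ha s ((hk s).mpr hs)
  let u : ℂ[X] := X ^ n + C c * k
  have hu : ∀ a' : Fin n → ℂ, u + coeffPoly n a' = monicPoly a' + C c * k := fun a' => by
    rw [monicPoly_eq]; ring
  let q : MvPolynomial (Fin n) ℂ := ((m * X).roots.map (evalFamily u n)).prod
  have hq : ∀ a', MvPolynomial.eval a' q ≠ 0 ↔ IsCoprime (monicPoly a' + C c * k) (m * X) := by
    intro a'
    rw [eval_prod_roots_ne_zero_iff hmX, isCoprime_iff_eval_ne_zero]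
    simp only [eval_evalFamily, hu]
  have hrow : ∀ (a' : Fin n → ℂ) i l, MvPolynomial.eval a' ((matrixFamily Z u n).adjugate.mulVec
      (fun l => MvPolynomial.C (w i l)) l) = (LinearMap.toMatrix'
        (aeval Z (monicPoly a' + C c * k))).adjugate.mulVec (w i) l := by
    intro a' i l
    have : (matrixFamily Z u n).adjugate.map (MvPolynomial.eval a') =
        ((matrixFamily Z u n).map (MvPolynomial.eval a')).adjugate :=
      RingHom.map_adjugate (MvPolynomial.eval a') _
    rw [map_eval_mulVec, this, map_eval_matrixFamily, hu]
    simp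
  refine ⟨_, rfl, fun ik => (matrixFamily Z u n).adjugate.mulVec
    (fun l => MvPolynomial.C (w ik.1 l)) ik.2, q, (hq a).mpr hc, ?_⟩
  rintro a' j' ⟨ha', rfl⟩ hqa'
  have hcop := (hq a').mp hqa'
  have hf0 := ne_zero_of_isCoprime_mul_X hcop
  have hcop' := hcop.of_mul_right_left
  have hW := hΦ _ hf0 hcop' (eval_ne_zero_of_isCoprime hZ hcop' W.1)
  rw [jacMk_eq_of_sub_mem_conductor hm hmA hf0 (monicPoly_ne_zero a') (hg := ha') (by
    rw [add_sub_cancel_left]; exact Ideal.mul_mem_left _ _ hkA)] at hW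
  refine Eq.trans ?_ (span_adjugate_mulVec (injective_aeval hZ hcop') (hW.trans hw.symm) hqa')
  congr 2
  ext i l
  exact congrArg (· / MvPolynomial.eval a' q) (hrow a' i l)

/-- Multiplication by a unit modulo `m`, in terms of the coefficients of the remainders. -/
theorem exists_mul_mod (hm : m.Monic) {h : ℂ[X]} (hh : IsCoprime h m) :
    ∃ S : (Fin m.natDegree → ℂ) →ₗ[ℂ] (Fin m.natDegree → ℂ), Function.Injective S ∧
      ∀ c, m ∣ coeffPoly _ (S c) - coeffPoly _ c * h := by
  let S : (Fin m.natDegree → ℂ) →ₗ[ℂ] (Fin m.natDegree → ℂ) := LinearMap.pi fun j =>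
    lcoeff ℂ j ∘ₗ modByMonicHom m ∘ₗ LinearMap.mulRight ℂ h ∘ₗ coeffPoly m.natDegree
  have hS : ∀ c, coeffPoly _ (S c) = (coeffPoly _ c * h) %ₘ m := fun c =>
    coeffPoly_coeff (by
      rw [← degree_eq_natDegree hm.ne_zero]; exact degree_modByMonic_lt _ hm)
  refine ⟨S, ?_, fun c => ?_⟩
  · rw [← LinearMap.ker_eq_bot, LinearMap.ker_eq_bot']
    intro c hc
    have h1 := hS c
    rw [hc, map_zero, eq_comm, modByMonic_eq_zero_iff_dvd hm] at h1
    have h2 := hh.symm.dvd_of_dvd_mul_right h1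
    refine coeffPoly_injective _ ?_
    rw [map_zero]
    refine eq_zero_of_dvd_of_degree_lt h2 ?_
    rw [degree_eq_natDegree hm.ne_zero]
    exact degree_coeffPoly_lt c
  · rw [hS]
    exact ⟨-((coeffPoly _ c * h) /ₘ m), by
      linear_combination modByMonic_add_div (coeffPoly _ c * h) m⟩

/-- Near Y, a rational family of solutions f of f(Z) Y' ⊆ W is constructed. Wherever f stays prime
to m, equal dimensions give f(Z) Y' = W, so f represents the class of Y'. -/
theorem isMorphism_gr_jac (hm : m.Monic) (hZ : aeval Z m = 0) (W : Gr M N)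
    (Φ : Jac (stab Z W.1) ≃ translates Z m W)
    (hΦ : ∀ (f : ℂ[X]) (_ : f ≠ 0) (_ : IsCoprime f m)
      (h : ∀ a ∈ singSet (stab Z W.1), f.eval a ≠ 0),
      (Φ (jacMk _ f h)).1.1.map (aeval Z f) = W.1) :
    IsMorphism (grStructure (translates Z m W)) (jacStructure (stab Z W.1)) Φ.symm := by
  obtain ⟨P, hP⟩ := exists_end_ker_eq W.1
  set n := m.natDegree with hn
  -- The Abel map takes monic polynomials. Adding m to a polynomial of degree less than n makes it
  -- monic of degree n without changing its value at Z.
  obtain ⟨b, hb⟩ : ∃ b : Fin n → ℂ, m = monicPoly b := by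
    obtain ⟨b, hb⟩ := exists_coeffPoly_eq (n := n) (p := m - X ^ n) (by
      have := degree_sub_lt_left (p := m) (q := X ^ n)
        (by rw [degree_X_pow, degree_eq_natDegree hm.ne_zero])
        hm.ne_zero (by rw [hm.leadingCoeff, (monic_X_pow n).leadingCoeff])
      rwa [degree_eq_natDegree hm.ne_zero] at this)
    exact ⟨b, by rw [monicPoly_eq, hb]; ring⟩
  have hmonic : ∀ c : Fin n → ℂ, monicPoly (c + b) = coeffPoly n c + m := fun c => by
    rw [hb, monicPoly_eq, monicPoly_eq, map_add]; ring
  have haeval : ∀ c : Fin n → ℂ, aeval Z (monicPoly (c + b)) = aeval Z (coeffPoly n c) :=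
    fun c => by rw [hmonic, map_add, hZ, add_zero]
  -- the linear system for `f` that expresses `f(Z) Y ⊆ W`
  let L : Matrix (Fin M × Fin N) (Fin n) (MvPolynomial (Fin M × Fin N) ℂ) := fun ik j =>
    ∑ l, MvPolynomial.C (LinearMap.toMatrix' (P * Z ^ (j : ℕ)) ik.2 l) * MvPolynomial.X (ik.1, l)
  have hL : ∀ (x : Fin M × Fin N → ℂ) (c : Fin n → ℂ) i k,
      (L.map (MvPolynomial.eval x)).mulVec c (i, k) =
        P (aeval Z (coeffPoly n c) fun k => x (i, k)) k := by
    intro x c i k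
    have h1 : ∀ j : Fin n, L.map (MvPolynomial.eval x) (i, k) j =
        (P * Z ^ (j : ℕ)) (fun k => x (i, k)) k := by
      intro j
      rw [← LinearMap.toMatrix'_mulVec (P * Z ^ (j : ℕ))]
      change MvPolynomial.eval x (L (i, k) j) = _
      simp [L, Matrix.mulVec, dotProduct]
    rw [aeval_coeffPoly, LinearMap.sum_apply, map_sum, Finset.sum_apply, Matrix.mulVec, dotProduct]
    refine Finset.sum_congr rfl fun j _ => ?_
    rw [h1, LinearMap.smul_apply, map_smul, Pi.smul_apply, smul_eq_mul, mul_comm]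
    rfl
  have hker : ∀ (x : Fin M × Fin N → ℂ) (Y : Submodule ℂ (Fin N → ℂ)) (c : Fin n → ℂ),
      Submodule.span ℂ (Set.range fun i k => x (i, k)) = Y →
      ((L.map (MvPolynomial.eval x)).mulVec c = 0 ↔ Y.map (aeval Z (coeffPoly n c)) ≤ W.1) := by
    rintro x _ c rfl
    rw [Submodule.map_span, Submodule.span_le, ← Set.range_comp, Set.range_subset_iff, funext_iff,
      Prod.forall]
    refine forall_congr' fun i => ?_
    rw [← hP, SetLike.mem_coe, LinearMap.mem_ker, funext_iff]
    refine forall_congr' fun k => ?_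
    rw [hL]
    rfl
  -- Multiplication modulo m by the unit g f', which carries Y' to Y, embeds the solutions for Y
  -- into those for Y'.
  have hdim : ∀ (x x' : Fin M × Fin N → ℂ) (Y Y' : translates Z m W),
      Submodule.span ℂ (Set.range fun i k => x (i, k)) = Y.1.1 →
      Submodule.span ℂ (Set.range fun i k => x' (i, k)) = Y'.1.1 →
      Module.finrank ℂ (LinearMap.ker (L.map (MvPolynomial.eval x)).mulVecLin) ≤
        Module.finrank ℂ (LinearMap.ker (L.map (MvPolynomial.eval x')).mulVecLin) := by
    intro x x' Y Y' hY hY'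
    obtain ⟨f, hf0, hf, hfW⟩ := Y.2
    obtain ⟨f', hf0', hf', hfW'⟩ := Y'.2
    obtain ⟨g, hg, hfg, hgf⟩ := exists_aeval_inverse hZ hf
    have hYY' : Y'.1.1.map (aeval Z (g * f')) = Y.1.1 := by
      rw [map_aeval_mul, hfW', ← hfW, ← map_aeval_mul, hgf]
      exact Submodule.map_id _
    obtain ⟨S, hSinj, hS⟩ := exists_mul_mod hm (hg.mul_left hf')
    have hmem : ∀ c ∈ LinearMap.ker (L.map (MvPolynomial.eval x)).mulVecLin,
        S c ∈ LinearMap.ker (L.map (MvPolynomial.eval x')).mulVecLin := by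
      intro c hc
      rw [LinearMap.mem_ker, Matrix.mulVecLin_apply] at hc ⊢
      rw [hker x' _ _ hY', aeval_eq_of_dvd_sub hZ (hS c), map_aeval_mul, hYY']
      exact (hker x _ c hY).mp hc
    refine LinearMap.finrank_le_finrank_of_injective (f := S.restrict hmem) ?_
    intro c c' h
    exact Subtype.ext (hSinj (congrArg Subtype.val h))
  rintro _ rfl x Y hY
  obtain ⟨f, hf0, hf, hfW⟩ := Y.2
  obtain ⟨c₀, hc₀⟩ := exists_coeffPoly_eq (n := n) (p := f %ₘ m) (by
    rw [hn, ← degree_eq_natDegree hm.ne_zero]; exact degree_modByMonic_lt f hm)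
  have hc₀f : m ∣ coeffPoly n c₀ - f := by
    rw [hc₀]; exact ⟨-(f /ₘ m), by linear_combination modByMonic_add_div f m⟩
  have hc₀Z := aeval_eq_of_dvd_sub hZ hc₀f
  obtain ⟨r, q, hq, hr, hLr⟩ := exists_rational_kernel L x c₀
    ((hker x _ c₀ hY).mpr (by rw [hc₀Z, hfW]))
  let e : ℂ → MvPolynomial (Fin M × Fin N) ℂ := fun s =>
    ∑ j, r j * MvPolynomial.C (s ^ (j : ℕ))
  have he : ∀ x' s, MvPolynomial.eval x' (e s) =
      (coeffPoly n fun j => MvPolynomial.eval x' (r j)).eval s := by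
    intro x' s
    simp [e, eval_coeffPoly]
  let t : MvPolynomial (Fin M × Fin N) ℂ := (m.roots.map e).prod
  have ht : ∀ x', MvPolynomial.eval x' t ≠ 0 ↔
      IsCoprime (coeffPoly n fun j => MvPolynomial.eval x' (r j)) m := by
    intro x'
    rw [eval_prod_roots_ne_zero_iff hm.ne_zero, isCoprime_iff_eval_ne_zero]
    simp only [he]
  -- The coordinates are r/q + b. The factor t enters the denominator only to restrict to the open
  -- set where the solution is prime to m.
  refine ⟨_, ⟨n, rfl⟩, fun j => r j * t + MvPolynomial.C (b j) * (q * t), q * t, ?_, ?_⟩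
  · have h1 : MvPolynomial.eval x t ≠ 0 := by
      rw [ht, show (fun j => MvPolynomial.eval x (r j)) = c₀ from funext hr]
      obtain ⟨v, hv⟩ := hc₀f
      rw [sub_eq_iff_eq_add.mp hv, add_comm]
      exact IsCoprime.add_mul_left_left hf v
    rw [map_mul, hq, one_mul]
    exact h1
  · intro x' Y' hY' hqt
    rw [map_mul] at hqt
    have hq0 := left_ne_zero_of_mul hqt
    have ht0 := right_ne_zero_of_mul hqt
    let c : Fin n → ℂ := (MvPolynomial.eval x' q)⁻¹ • fun j => MvPolynomial.eval x' (r j)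
    have hcoord : (fun j => MvPolynomial.eval x' (r j * t + MvPolynomial.C (b j) * (q * t)) /
        MvPolynomial.eval x' (q * t)) = c + b := by
      ext j
      simp only [map_add, map_mul, MvPolynomial.eval_C, Pi.add_apply, Pi.smul_apply, smul_eq_mul, c]
      field_simp
    have hcW : Y'.1.1.map (aeval Z (coeffPoly n c)) ≤ W.1 := by
      rw [← hker x' _ c hY', Matrix.mulVec_smul, hLr x' hq0 (hdim x x' Y Y' hY hY'), smul_zero]
    have hcop : IsCoprime (coeffPoly n c) m := by
      have h1 := (ht x').mp ht0
      rw [map_smul, smul_eq_C_mul]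
      exact (isCoprime_mul_unit_left_left
        (isUnit_C.mpr (IsUnit.mk0 _ (inv_ne_zero hq0))) _ _).mpr h1
    have hcop' : IsCoprime (monicPoly (c + b)) m := by
      rw [hmonic]
      simpa using IsCoprime.add_mul_left_left hcop 1
    have hna := eval_ne_zero_of_isCoprime hZ hcop' W.1
    have hW := hΦ _ (monicPoly_ne_zero _) hcop' hna
    have hY'W : Y'.1.1.map (aeval Z (monicPoly (c + b))) = W.1 := by
      rw [haeval]
      refine Submodule.eq_of_le_of_finrank_eq hcW ?_
      rw [finrank_map_aeval hZ _ hcop, Y'.1.2, W.2]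
    have hfin : Φ.symm Y' = jacMk (stab Z W.1) (monicPoly (c + b)) hna := by
      rw [Equiv.symm_apply_eq]
      exact Subtype.ext (Subtype.ext (map_aeval_injective hZ hcop' (hY'W.trans hW.symm)))
    have : (abelMap (stab Z W.1) n).param (c + b) (Φ.symm Y') := ⟨hna, hfin⟩
    rw [← hcoord] at this
    exact this

end Morphisms

/-! ## Multiplication operators on conditions -/

section Conditions

/-- The operator on conditions that is dual to multiplication of functions by `F`. -/
def mulCond (F : ℂ → ℂ) : Cond →ₗ[ℂ] Cond :=
  Finsupp.linearCombination ℂ fun x : ℂ × ℕ =>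
    ∑ i ∈ Finset.range (x.2 + 1),
      Finsupp.single (x.1, x.2 - i) ((x.2.choose i : ℂ) * iteratedDeriv i F x.1)

theorem mulCond_single (F : ℂ → ℂ) (x : ℂ × ℕ) :
    mulCond F (Finsupp.single x 1) = ∑ i ∈ Finset.range (x.2 + 1),
      Finsupp.single (x.1, x.2 - i) ((x.2.choose i : ℂ) * iteratedDeriv i F x.1) := by
  simp [mulCond]

theorem act_eq_mulCond (g : ℂ → ℂˣ) : act g = mulCond fun z => ((g z)⁻¹ : ℂ) := rfl

theorem applyCond_single (x : ℂ × ℕ) (c : ℂ) (f : ℂ[X]) :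
    applyCond (Finsupp.single x c) f = c * (derivative^[x.2] f).eval x.1 := by
  simp [applyCond, d, leval, Module.End.pow_apply]

theorem iteratedDeriv_eval (p : ℂ[X]) (i : ℕ) :
    iteratedDeriv i (fun z => p.eval z) = fun z => (derivative^[i] p).eval z := by
  induction i with
  | zero => simp
  | succ i ih =>
    rw [iteratedDeriv_succ, ih]
    ext z
    rw [Function.iterate_succ_apply', Polynomial.deriv]

/-- This is the Leibniz rule. -/
theorem applyCond_mulCond (p : ℂ[X]) (c : Cond) (r : ℂ[X]) :
    applyCond (mulCond (fun z => p.eval z) c) r = applyCond c (p * r) := by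
  induction c using Finsupp.induction_linear with
  | zero => simp
  | add c c' h h' => simp only [map_add, LinearMap.add_apply, h, h']
  | single x a =>
    have hx : Finsupp.single x a = a • Finsupp.single x (1 : ℂ) := by simp
    rw [hx, map_smul, map_smul, map_smul, LinearMap.smul_apply, LinearMap.smul_apply,
      mulCond_single, map_sum, LinearMap.sum_apply, applyCond_single, one_mul, mul_comm p r,
      iterate_derivative_mul, eval_finsetSum]
    congr 1
    refine Finset.sum_congr rfl fun i _ => ?_
    rw [applyCond_single, iteratedDeriv_eval]
    simp
    ring

theorem mulCond_mem_boundedCond (F : ℂ → ℂ) {μ : ℂ →₀ ℕ} {c : Cond} (hc : c ∈ boundedCond μ) :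
    mulCond F c ∈ boundedCond μ := by
  have h : boundedCond μ ≤ (boundedCond μ).comap (mulCond F) := by
    conv_lhs => rw [boundedCond, Finsupp.supported_eq_span_single]
    rw [Submodule.span_le]
    rintro _ ⟨x, hx, rfl⟩
    rw [SetLike.mem_coe, Submodule.mem_comap, mulCond_single]
    refine Submodule.sum_mem _ fun i _ => Finsupp.single_mem_supported ℂ _ ?_
    exact lt_of_le_of_lt (Nat.sub_le _ _) hx
  exact h hc

/-- A nonzero condition does not vanish on all polynomials. -/
theorem applyCond_injective : Function.Injective applyCond := by
  classical
  rw [← LinearMap.ker_eq_bot, LinearMap.ker_eq_bot']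
  intro c hc
  by_contra hc0
  obtain ⟨x, hx⟩ := Finsupp.support_nonempty_iff.mpr hc0
  -- At one point a of the support, the highest order l is isolated: the test polynomial (z - a)^l ∏
  -- (z - s)^B, with B above all orders that occur, is annihilated by every other term of c.
  obtain ⟨y, hy, hymax⟩ := Finset.exists_max_image (c.support.filter fun y => y.1 = x.1) Prod.snd
    ⟨x, by simpa using hx⟩
  rw [Finset.mem_filter] at hy
  set a := y.1
  set l := y.2
  let B := c.support.sup Prod.snd + 1
  let q : ℂ[X] := ∏ s ∈ (c.support.image Prod.fst).erase a, (X - C s) ^ B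
  have hqa : q.eval a ≠ 0 := by
    simp only [q, eval_prod, eval_pow, eval_sub, eval_X, eval_C]
    refine Finset.prod_ne_zero_iff.mpr fun s hs => pow_ne_zero _ (sub_ne_zero.mpr ?_)
    exact (Finset.ne_of_mem_erase hs).symm
  have hq0 : q ≠ 0 := by rintro h; simp [h] at hqa
  let f : ℂ[X] := (X - C a) ^ l * q
  have hf0 : f ≠ 0 := mul_ne_zero (pow_ne_zero _ (X_sub_C_ne_zero a)) hq0
  have hfa : f.rootMultiplicity a = l := by
    rw [rootMultiplicity_mul hf0, rootMultiplicity_X_sub_C_pow,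
      rootMultiplicity_eq_zero hqa, add_zero]
  have hlow : ∀ k < l, (derivative^[k] f).eval a = 0 := by
    intro k hk
    exact isRoot_iterate_derivative_of_lt_rootMultiplicity (by rwa [hfa])
  have htop : (derivative^[l] f).eval a ≠ 0 := by
    intro h
    have : l < f.rootMultiplicity a :=
      (lt_rootMultiplicity_iff_isRoot_iterate_derivative hf0).mpr fun k hk => by
        rcases hk.lt_or_eq with hk | rfl
        · exact hlow k hk
        · exact h
    omega
  have hother : ∀ z ∈ c.support, z.1 ≠ a → (derivative^[z.2] f).eval z.1 = 0 := by
    intro z hz hza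
    apply isRoot_iterate_derivative_of_lt_rootMultiplicity
    have h1 : (X - C z.1) ^ B ∣ f := by
      refine Dvd.dvd.mul_left (Finset.dvd_prod_of_mem (fun s => (X - C s) ^ B) ?_) _
      exact Finset.mem_erase.mpr ⟨hza, Finset.mem_image_of_mem _ hz⟩
    have h2 := (le_rootMultiplicity_iff hf0).mpr h1
    exact lt_of_lt_of_le (Nat.lt_succ_of_le (Finset.le_sup (f := Prod.snd) hz)) h2
  have hsum : applyCond c f = c y * (derivative^[l] f).eval a := by
    conv_lhs => rw [← Finsupp.sum_single c]
    rw [Finsupp.sum, map_sum, LinearMap.sum_apply, Finset.sum_eq_single y]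
    · rw [applyCond_single]
    · intro z hz hzy
      rw [applyCond_single]
      by_cases hza : z.1 = a
      · have hzl : z.2 ≤ l := hymax z (by simpa [hza, hy.2] using hz)
        have hne : z.2 ≠ l := fun h => hzy (Prod.ext hza h)
        rw [hza, hlow _ (lt_of_le_of_ne hzl hne), mul_zero]
      · rw [hother z hz hza, mul_zero]
    · intro h; exact absurd hy.1 h
  rw [hc, LinearMap.zero_apply] at hsum
  exact mul_ne_zero (Finsupp.mem_support_iff.mp hy.1) htop hsum.symm

theorem exists_finset_eq_bound (μ : ℂ →₀ ℕ) :
    ∃ t : Finset (ℂ × ℕ), {x : ℂ × ℕ | x.2 < μ x.1} = t ∧ t.card = dimBound μ := by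
  classical
  refine ⟨(μ.support.sigma fun a => Finset.range (μ a)).map
    (Equiv.sigmaEquivProd ℂ ℕ).toEmbedding, ?_, by simp [dimBound, Finsupp.sum]⟩
  ext ⟨a, l⟩
  simp
  intro h
  omega

theorem nonempty_equiv_boundedCond {μ : ℂ →₀ ℕ} {N : ℕ} (hμ : dimBound μ = N) :
    Nonempty ((Fin N → ℂ) ≃ₗ[ℂ] boundedCond μ) := by
  obtain ⟨t, ht, hcard⟩ := exists_finset_eq_bound μ
  rw [hμ] at hcard
  have e : boundedCond μ ≃ₗ[ℂ] (t →₀ ℂ) := by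
    unfold boundedCond
    rw [ht]
    exact Finsupp.supportedEquivFinsupp (M := ℂ) (R := ℂ) (t : Set (ℂ × ℕ))
  exact ⟨(e ≪≫ₗ Finsupp.linearEquivFunOnFinite ℂ ℂ t ≪≫ₗ
    LinearEquiv.funCongrLeft ℂ ℂ (t.equivFinOfCardEq hcard).symm).symm⟩

end Conditions

/-! ## Entire functions modulo a polynomial -/

section Interpolation

theorem exists_differentiable_slope {H : ℂ → ℂ} (hH : Differentiable ℂ H) (a : ℂ) :
    ∃ K : ℂ → ℂ, Differentiable ℂ K ∧ K a = deriv H a ∧ ∀ z, H z = H a + (z - a) * K z := by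
  refine ⟨dslope H a, ?_, dslope_same H a, fun z => ?_⟩
  · rw [← differentiableOn_univ, Complex.differentiableOn_dslope Filter.univ_mem]
    exact hH.differentiableOn
  · have := sub_smul_dslope H a z
    rw [smul_eq_mul] at this
    rw [this]; ring

/-- Hermite interpolation of entire functions by polynomials. -/
theorem exists_polynomial_interpolation (s : Multiset ℂ) {F : ℂ → ℂ} (hF : Differentiable ℂ F) :
    ∃ (p : ℂ[X]) (H : ℂ → ℂ), Differentiable ℂ H ∧
      ∀ z, F z = p.eval z + ((s.map fun a => X - C a).prod).eval z * H z := by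
  induction s using Multiset.induction_on with
  | empty => exact ⟨0, F, hF, fun z => by simp⟩
  | cons a s ih =>
    obtain ⟨p, H, hH, h⟩ := ih
    obtain ⟨K, hK, -, hHK⟩ := exists_differentiable_slope hH a
    refine ⟨p + C (H a) * (s.map fun a => X - C a).prod, K, hK, fun z => ?_⟩
    rw [h z, hHK z]
    simp
    ring

/-- An entire function without zeros at the given points is congruent to the exponential of a
polynomial. -/
theorem exists_exp_interpolation (s : Multiset ℂ) {F : ℂ → ℂ} (hF : Differentiable ℂ F)
    (hs : ∀ a ∈ s, F a ≠ 0) : ∃ (p : ℂ[X]) (H : ℂ → ℂ), Differentiable ℂ H ∧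
      ∀ z, F z = Complex.exp (p.eval z) + ((s.map fun a => X - C a).prod).eval z * H z := by
  induction s using Multiset.induction_on with
  | empty =>
    exact ⟨0, fun z => F z - 1, hF.sub_const 1, fun z => by simp⟩
  | cons a s ih =>
    obtain ⟨p, H, hH, h⟩ := ih fun b hb => hs b (Multiset.mem_cons_of_mem hb)
    set m : ℂ[X] := (s.map fun a => X - C a).prod with hm
    obtain ⟨k, hk, hk0, hexp⟩ := exists_differentiable_slope Complex.differentiable_exp 0
    have hexp' : ∀ w, Complex.exp w = 1 + w * k w := fun w => by
      have := hexp w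
      rwa [Complex.exp_zero, sub_zero] at this
    have hk1 : k 0 = 1 := by rw [hk0, Complex.deriv_exp, Complex.exp_zero]
    have hstep : ∀ c z, F z = Complex.exp ((p + C c * m).eval z) + m.eval z *
        (H z - Complex.exp (p.eval z) * c * k (c * m.eval z)) := by
      intro c z
      rw [h z, eval_add, eval_mul, eval_C, Complex.exp_add, hexp' (c * m.eval z)]
      ring
    -- The new remainder must vanish at a. If m(a) = 0 this is a linear equation for c, because k(0)
    -- = 1; otherwise c is chosen so that e^{p + c m} takes the value F(a) at a.
    obtain ⟨c, hc⟩ : ∃ c, H a - Complex.exp (p.eval a) * c * k (c * m.eval a) = 0 := by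
      by_cases hma : m.eval a = 0
      · refine ⟨H a * (Complex.exp (p.eval a))⁻¹, ?_⟩
        rw [hma, mul_zero, hk1]
        field_simp [Complex.exp_ne_zero]
        ring
      · refine ⟨(Complex.log (F a) - p.eval a) / m.eval a, ?_⟩
        have h1 := hstep ((Complex.log (F a) - p.eval a) / m.eval a) a
        have h2 : (p + C ((Complex.log (F a) - p.eval a) / m.eval a) * m).eval a =
            Complex.log (F a) := by
          rw [eval_add, eval_mul, eval_C, div_mul_cancel₀ _ hma]; ring
        rw [h2, Complex.exp_log (hs a (Multiset.mem_cons_self a s))] at h1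
        exact (mul_eq_zero.mp (left_eq_add.mp h1)).resolve_left hma
    obtain ⟨K, hK, -, hHK⟩ := exists_differentiable_slope
      (H := fun z => H z - Complex.exp (p.eval z) * c * k (c * m.eval z)) (by fun_prop) a
    refine ⟨p + C c * m, K, hK, fun z => ?_⟩
    rw [hstep c z, hHK z, hc, Multiset.map_cons, Multiset.prod_cons, ← hm, eval_mul]
    simp
    ring

/-- Congruence of entire functions modulo a polynomial. -/
def Cong (m : ℂ[X]) (F G : ℂ → ℂ) : Prop :=
  ∃ H : ℂ → ℂ, Differentiable ℂ H ∧ ∀ z, F z = G z + m.eval z * H z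

variable {m : ℂ[X]} {F G F' G' : ℂ → ℂ}

theorem Cong.symm (h : Cong m F G) : Cong m G F := by
  obtain ⟨H, hH, e⟩ := h
  exact ⟨fun z => -H z, hH.neg, fun z => by rw [e z]; ring⟩

theorem Cong.trans {K : ℂ → ℂ} (h : Cong m F G) (h' : Cong m G K) : Cong m F K := by
  obtain ⟨H, hH, e⟩ := h
  obtain ⟨H', hH', e'⟩ := h'
  exact ⟨fun z => H z + H' z, hH.add hH', fun z => by rw [e z, e' z]; ring⟩

theorem Cong.mul (h : Cong m F G) (h' : Cong m F' G') (hF' : Differentiable ℂ F')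
    (hG : Differentiable ℂ G) : Cong m (fun z => F z * F' z) (fun z => G z * G' z) := by
  obtain ⟨H, hH, e⟩ := h
  obtain ⟨H', hH', e'⟩ := h'
  refine ⟨fun z => H z * F' z + G z * H' z, by fun_prop, fun z => ?_⟩
  linear_combination F' z * e z + G z * e' z

/-- F - G vanishes at a to order at least n. -/
theorem Cong.iteratedDeriv_eq (h : Cong m F G) (hF : Differentiable ℂ F)
    (hG : Differentiable ℂ G) {a : ℂ} {n : ℕ} (hn : (X - C a) ^ n ∣ m) {i : ℕ} (hi : i < n) :
    iteratedDeriv i F a = iteratedDeriv i G a := by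
  obtain ⟨H, hH, e⟩ := h
  obtain ⟨q, rfl⟩ := hn
  have hFG : AnalyticAt ℂ (F - G) a := (hF.sub hG).analyticAt a
  have hord : (n : ℕ∞) ≤ analyticOrderAt (F - G) a := by
    rw [natCast_le_analyticOrderAt hFG]
    refine ⟨fun z => q.eval z * H z, ?_, Filter.Eventually.of_forall fun z => ?_⟩
    · have : Differentiable ℂ fun z => q.eval z * H z := by fun_prop
      exact this.analyticAt a
    · simp [e z]
      ring
  have := (natCast_le_analyticOrderAt_iff_iteratedDeriv_eq_zero hFG).mp hord i hi
  rw [iteratedDeriv_sub hF.contDiff.contDiffAt hG.contDiff.contDiffAt] at this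
  exact sub_eq_zero.mp this

end Interpolation

/-! ## The group `Γ₊` as units modulo the bounding polynomial -/

section Bound

/-- The polynomial `∏ (z - a)^{μ(a)}`. -/
def boundPoly (μ : ℂ →₀ ℕ) : ℂ[X] := ((Finsupp.toMultiset μ).map fun a => X - C a).prod

theorem monic_boundPoly (μ : ℂ →₀ ℕ) : (boundPoly μ).Monic :=
  monic_multiset_prod_of_monic _ _ fun a _ => monic_X_sub_C a

theorem X_sub_C_pow_dvd_boundPoly (μ : ℂ →₀ ℕ) (a : ℂ) : (X - C a) ^ μ a ∣ boundPoly μ := by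
  classical
  rw [← le_rootMultiplicity_iff (monic_boundPoly μ).ne_zero, ← count_roots, boundPoly,
    roots_multiset_prod_X_sub_C, Finsupp.count_toMultiset]

/-- A condition bounded by μ sees only the derivatives of F at a of order less than μ(a). -/
theorem Cong.mulCond_eq {μ : ℂ →₀ ℕ} {F G : ℂ → ℂ} (h : Cong (boundPoly μ) F G)
    (hF : Differentiable ℂ F) (hG : Differentiable ℂ G) {c : Cond} (hc : c ∈ boundedCond μ) :
    mulCond F c = mulCond G c := by
  have hle : boundedCond μ ≤ LinearMap.eqLocus (mulCond F) (mulCond G) := by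
    conv_lhs => rw [boundedCond, Finsupp.supported_eq_span_single]
    rw [Submodule.span_le]
    rintro _ ⟨x, hx, rfl⟩
    rw [SetLike.mem_coe, LinearMap.mem_eqLocus, mulCond_single, mulCond_single]
    refine Finset.sum_congr rfl fun i hi => ?_
    rw [h.iteratedDeriv_eq hF hG (X_sub_C_pow_dvd_boundPoly μ x.1)]
    exact lt_of_lt_of_le (Finset.mem_range.mp hi) hx
  exact hle hc

theorem differentiable_of_mem_gammaPlus {g : ℂ → ℂˣ} (hg : g ∈ gammaPlus) :
    Differentiable ℂ fun z => (g z : ℂ) := by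
  have hinv : ∀ h : ℂ → ℂˣ, (Differentiable ℂ fun z => (h z : ℂ)) →
      Differentiable ℂ fun z => ((h⁻¹) z : ℂ) := by
    intro h hh
    have : (fun z => ((h⁻¹) z : ℂ)) = fun z => (h z : ℂ)⁻¹ := by
      ext z; simp
    rw [this]
    exact hh.fun_inv fun z => (h z).ne_zero
  induction hg using Subgroup.closure_induction with
  | mem g hg =>
    obtain ⟨c, n, -, h⟩ := hg
    rw [show (fun z => (g z : ℂ)) = fun z => Complex.exp (c * z ^ n) from funext h]
    fun_prop
  | one => simp
  | mul g h _ _ hg hh =>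
    simpa using hg.fun_mul hh
  | inv g _ hg => exact hinv g hg

/-- The function `e^{z p(z)}` as a function with values in the units. -/
def expUnit (p : ℂ[X]) : ℂ → ℂˣ := fun z =>
  Units.mk0 (Complex.exp (z * p.eval z)) (Complex.exp_ne_zero _)

theorem expUnit_mem (p : ℂ[X]) : expUnit p ∈ gammaPlus := by
  induction p using Polynomial.induction_on' with
  | add p q hp hq =>
    have : expUnit (p + q) = expUnit p * expUnit q := by
      ext z
      simp [expUnit, mul_add, Complex.exp_add]
    rw [this]
    exact mul_mem hp hq
  | monomial n c =>
    refine Subgroup.subset_closure ⟨c, n + 1, by omega, fun z => ?_⟩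
    simp [expUnit]
    congr 1
    ring

end Bound

/-! ### Multiplication by z on ℂ^N ≅ 𝒞(μ): spectral rings and orbits -/

section Identification

variable {M N : ℕ} {μ : ℂ →₀ ℕ} (φ : (Fin N → ℂ) ≃ₗ[ℂ] boundedCond μ)

/-- The inclusion of `ℂ^N ≅ 𝒞(μ)` in `𝒞`. -/
def condInclusion : (Fin N → ℂ) →ₗ[ℂ] Cond := (boundedCond μ).subtype ∘ₗ φ.toLinearMap

theorem condInclusion_mem (w : Fin N → ℂ) : condInclusion φ w ∈ boundedCond μ := (φ w).2

theorem condInclusion_injective : Function.Injective (condInclusion φ) :=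
  Subtype.val_injective.comp φ.injective

theorem condOf_eq_map (W : Gr M N) : condOf φ W = W.1.map (condInclusion φ) :=
  (Submodule.map_comp _ _ _).symm

/-- The operator on `ℂ^N ≅ 𝒞(μ)` that is dual to multiplication by `z`. -/
def mulZ : Module.End ℂ (Fin N → ℂ) :=
  φ.symm.toLinearMap ∘ₗ ((mulCond fun z => (X : ℂ[X]).eval z).restrict
    fun _ hc => mulCond_mem_boundedCond _ hc) ∘ₗ φ.toLinearMap

theorem condInclusion_mulZ (w : Fin N → ℂ) :
    condInclusion φ (mulZ φ w) = mulCond (fun z => (X : ℂ[X]).eval z) (condInclusion φ w) := by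
  simp [condInclusion, mulZ]

theorem applyCond_aeval_mulZ (p r : ℂ[X]) (w : Fin N → ℂ) :
    applyCond (condInclusion φ (aeval (mulZ φ) p w)) r = applyCond (condInclusion φ w) (p * r) := by
  induction p using Polynomial.induction_on generalizing r with
  | C a => simp [← smul_eq_C_mul]
  | add p q hp hq => simp only [map_add, LinearMap.add_apply, add_mul, hp, hq]
  | monomial n a h =>
    rw [pow_succ', show C a * (X * X ^ n) = X * (C a * X ^ n) by ring, map_mul, aeval_X,
      Module.End.mul_apply, condInclusion_mulZ, applyCond_mulCond, h]
    congr 1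
    ring

theorem condInclusion_aeval_mulZ (p : ℂ[X]) (w : Fin N → ℂ) :
    condInclusion φ (aeval (mulZ φ) p w) =
      mulCond (fun z => p.eval z) (condInclusion φ w) := by
  refine applyCond_injective (LinearMap.ext fun r => ?_)
  rw [applyCond_aeval_mulZ, applyCond_mulCond]

theorem Cong.aeval_mulZ_eq {p q : ℂ[X]}
    (h : Cong (boundPoly μ) (fun z => p.eval z) fun z => q.eval z) :
    aeval (mulZ φ) p = aeval (mulZ φ) q := by
  refine LinearMap.ext fun w => condInclusion_injective φ ?_
  rw [condInclusion_aeval_mulZ, condInclusion_aeval_mulZ]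
  exact h.mulCond_eq p.differentiable q.differentiable (condInclusion_mem φ w)

theorem aeval_mulZ_boundPoly : aeval (mulZ φ) (boundPoly μ) = 0 := by
  rw [← map_zero (aeval (R := ℂ) (mulZ φ))]
  exact Cong.aeval_mulZ_eq φ ⟨fun _ => 1, differentiable_const 1, fun z => by simp⟩

/-- p(Z) is dual to multiplication by p. A finite-dimensional space of functionals equals the
annihilator of its common zeros, so p preserves the zeros if and only if p(Z) preserves W. -/
theorem spectralRing_condOf (W : Gr M N) : spectralRing (condOf φ W) = stab (mulZ φ) W.1 := by
  have hsol : ∀ f, f ∈ solutions (condOf φ W) ↔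
      ∀ w ∈ W.1, applyCond (condInclusion φ w) f = 0 := by
    intro f
    rw [condOf_eq_map]
    constructor
    · intro h w hw
      exact h _ (Submodule.mem_map_of_mem hw)
    · rintro h _ ⟨w, hw, rfl⟩
      exact h w hw
  let ψ : (Fin N → ℂ) →ₗ[ℂ] Module.Dual ℂ ℂ[X] := applyCond ∘ₗ condInclusion φ
  have hψ : Function.Injective ψ := applyCond_injective.comp (condInclusion_injective φ)
  have hsol' : ∀ f, f ∈ solutions (condOf φ W) ↔ f ∈ (W.1.map ψ).dualCoannihilator := by
    intro f
    rw [hsol, Submodule.mem_dualCoannihilator]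
    constructor
    · rintro h _ ⟨w, hw, rfl⟩
      exact h w hw
    · intro h w hw
      exact h _ (Submodule.mem_map_of_mem hw)
  ext p
  constructor
  · intro hp w hw
    have h1 : ψ (aeval (mulZ φ) p w) ∈ (W.1.map ψ).dualCoannihilator.dualAnnihilator := by
      rw [Submodule.mem_dualAnnihilator]
      intro f hf
      have h2 := hp f ((hsol' f).mpr hf)
      exact (applyCond_aeval_mulZ φ p f w).trans ((hsol _).mp h2 w hw)
    rw [Subspace.dualCoannihilator_dualAnnihilator_eq] at h1
    obtain ⟨w', hw', h3⟩ := h1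
    rwa [← hψ h3]
  · intro hp f hf
    rw [hsol] at hf ⊢
    intro w hw
    rw [← applyCond_aeval_mulZ]
    exact hf _ (hp w hw)

/-- Every element of `Γ₊` acts as the inverse of a unit modulo the bounding polynomial. -/
theorem exists_unit_of_mem_gammaPlus (μ : ℂ →₀ ℕ) {g : ℂ → ℂˣ} (hg : g ∈ gammaPlus) :
    ∃ v : ℂ[X], v ≠ 0 ∧ IsCoprime v (boundPoly μ) ∧
      Cong (boundPoly μ) (fun z => v.eval z) fun z => (g z : ℂ) := by
  obtain ⟨p, H, hH, h⟩ := exists_polynomial_interpolation (Finsupp.toMultiset μ)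
    (differentiable_of_mem_gammaPlus hg)
  have key : ∀ c : ℂ, Cong (boundPoly μ) (fun z => (p + C c * boundPoly μ).eval z)
      fun z => (g z : ℂ) := fun c =>
    ⟨fun z => c - H z, by fun_prop, fun z => by
      beta_reduce
      rw [h z, eval_add, eval_mul, eval_C, boundPoly]; ring⟩
  have key' : ∀ v : ℂ[X], Cong (boundPoly μ) (fun z => v.eval z) (fun z => (g z : ℂ)) →
      IsCoprime v (boundPoly μ) := by
    rintro v ⟨K, -, hK⟩
    refine isCoprime_iff_eval_ne_zero.mpr fun a ha => ?_
    have := hK a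
    rw [ha, zero_mul, add_zero] at this
    exact this.trans_ne (g a).ne_zero
  -- The interpolant is 0 only if the bounding polynomial has no roots; adding that polynomial then
  -- gives a nonzero representative.
  by_cases hp : p = 0
  · refine ⟨p + C 1 * boundPoly μ, ?_, key' _ (key 1), key 1⟩
    simpa [hp] using (monic_boundPoly μ).ne_zero
  · have := key 0
    simp only [C_0, zero_mul, add_zero] at this
    exact ⟨p, hp, key' _ this, this⟩

/-- The action of g is multiplication by 1/g, so the polynomial v congruent to g carries W' back to
W. -/
theorem condOf_eq_map_act_iff {g : ℂ → ℂˣ} (hg : g ∈ gammaPlus) {v : ℂ[X]}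
    (hv : Cong (boundPoly μ) (fun z => v.eval z) fun z => (g z : ℂ)) (W W' : Gr M N) :
    condOf φ W' = (condOf φ W).map (act g) ↔ W'.1.map (aeval (mulZ φ) v) = W.1 := by
  have hg' : (fun z => ((g z)⁻¹ : ℂ)) = fun z => ((g⁻¹) z : ℂ) := by ext z; simp
  have hgd := differentiable_of_mem_gammaPlus hg
  have hgd' := differentiable_of_mem_gammaPlus (inv_mem hg)
  obtain ⟨u, -, -, hu⟩ := exists_unit_of_mem_gammaPlus μ (inv_mem hg)
  have hact : ∀ w, act g (condInclusion φ w) = condInclusion φ (aeval (mulZ φ) u w) := by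
    intro w
    rw [act_eq_mulCond, condInclusion_aeval_mulZ, hg']
    exact hu.symm.mulCond_eq hgd' u.differentiable (condInclusion_mem φ w)
  have huv : aeval (mulZ φ) (u * v) = 1 := by
    rw [← map_one (aeval (R := ℂ) (mulZ φ))]
    refine Cong.aeval_mulZ_eq φ ?_
    have := hu.mul hv v.differentiable hgd'
    simpa using this
  have hvu : aeval (mulZ φ) (v * u) = 1 := by rw [mul_comm, huv]
  have hmap : (condOf φ W).map (act g) = (W.1.map (aeval (mulZ φ) u)).map (condInclusion φ) := by
    rw [condOf_eq_map, ← Submodule.map_comp, ← Submodule.map_comp]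
    exact congrArg (fun f => Submodule.map f W.1) (LinearMap.ext hact)
  rw [hmap, condOf_eq_map, (Submodule.map_injective_of_injective
    (condInclusion_injective φ)).eq_iff]
  constructor
  · intro h
    rw [h, ← map_aeval_mul, hvu]
    exact Submodule.map_id _
  · intro h
    rw [← h, ← map_aeval_mul, huv]
    exact (Submodule.map_id _).symm

/-- The orbits of `Γ₊` are the orbits of the units modulo the bounding polynomial. -/
theorem orbit_eq_translates (W : Gr M N) :
    orbit φ W = translates (mulZ φ) (boundPoly μ) W := by
  ext W'
  constructor
  · rintro ⟨g, hg, h⟩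
    obtain ⟨v, hv0, hv, hvg⟩ := exists_unit_of_mem_gammaPlus μ hg
    exact ⟨v, hv0, hv, (condOf_eq_map_act_iff φ hg hvg W W').mp h⟩
  · rintro ⟨f, hf0, hf, h⟩
    obtain ⟨p, H, hH, hp⟩ := exists_exp_interpolation (Finsupp.toMultiset μ)
      f.differentiable (fun a ha => isCoprime_iff_eval_ne_zero.mp hf a (by
        have : a ∈ (boundPoly μ).roots := by rwa [boundPoly, roots_multiset_prod_X_sub_C]
        exact isRoot_of_mem_roots this))
    have hg := expUnit_mem p.divX
    obtain ⟨v, hv0, hv, hvg⟩ := exists_unit_of_mem_gammaPlus μ hg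
    refine ⟨expUnit p.divX, hg, (condOf_eq_map_act_iff φ hg hvg W W').mpr ?_⟩
    -- Γ₊ has only exponents without constant term, so e^{p(0)} is split off; being a nonzero
    -- scalar, it does not affect images of subspaces.
    have hc : Cong (boundPoly μ) (fun z => f.eval z)
        fun z => (C (Complex.exp (p.coeff 0)) * v).eval z := by
      have h1 : Cong (boundPoly μ) (fun z => f.eval z) fun z => Complex.exp (p.eval z) :=
        ⟨H, hH, hp⟩
      refine h1.trans ?_
      obtain ⟨K, hK, hKv⟩ := hvg.symm
      refine ⟨fun z => Complex.exp (p.coeff 0) * K z, by fun_prop, fun z => ?_⟩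
      have h2 : p.eval z = p.coeff 0 + z * p.divX.eval z := by
        conv_lhs => rw [← divX_mul_X_add p]
        simp; ring
      have h3 := hKv z
      simp only [expUnit, Units.val_mk0] at h3
      beta_reduce
      rw [h2, Complex.exp_add, h3, eval_mul, eval_C]
      ring
    rw [Cong.aeval_mulZ_eq φ hc, ← smul_eq_C_mul, map_smul,
      Submodule.map_smul _ _ _ (Complex.exp_ne_zero _)] at h
    exact h

end Identification

/-! ### Orbits as generalized Jacobians -/

section Orbits

variable {M N : ℕ} {μ : ℂ →₀ ℕ}

/-- Compositions of elements of `Γ₊` correspond to sums in the generalized Jacobian. -/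
theorem exists_hom_gammaPlus_jac (φ : (Fin N → ℂ) ≃ₗ[ℂ] boundedCond μ) (W : Gr M N) :
    ∃ κ : gammaPlus →* Multiplicative (Jac (stab (mulZ φ) W.1)), ∀ g : gammaPlus,
      ∃ (v : ℂ[X]) (hv : IsCoprime v (boundPoly μ)), v ≠ 0 ∧
        Cong (boundPoly μ) (fun z => v.eval z) (fun z => (g.1 z : ℂ)) ∧
        (κ g).toAdd = jacMk _ v (eval_ne_zero_of_isCoprime (aeval_mulZ_boundPoly φ) hv W.1) := by
  have hZ := aeval_mulZ_boundPoly φ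
  have hm := (monic_boundPoly μ).ne_zero
  choose v hv0 hv hvg using fun g : gammaPlus => exists_unit_of_mem_gammaPlus μ g.2
  let κ : gammaPlus →* Multiplicative (Jac (stab (mulZ φ) W.1)) := MonoidHom.mk'
    (fun g => Multiplicative.ofAdd (jacMk _ (v g) (eval_ne_zero_of_isCoprime hZ (hv g) W.1))) (by
    intro g h
    have hgh : Cong (boundPoly μ) (fun z => (v (g * h)).eval z)
        fun z => (v g * v h).eval z := by
      refine (hvg (g * h)).trans ?_
      have := ((hvg g).mul (hvg h) (v h).differentiable
        (differentiable_of_mem_gammaPlus g.2)).symm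
      simpa using this
    have hcop := (hv g).mul_left (hv h)
    have h0 := mul_ne_zero (hv0 g) (hv0 h)
    have hT := Cong.aeval_mulZ_eq φ hgh
    -- The polynomials chosen for g h and for g and h multiply only modulo m. Their classes agree
    -- because both sides carry the same W' to W.
    obtain ⟨W', hW'⟩ := exists_map_aeval_eq hZ W.1 hcop
    rw [← ofAdd_add, ← jacMk_mul _ _ (hv0 g) (hv0 h) (eval_ne_zero_of_isCoprime hZ hcop W.1)]
    congr 1
    exact (jacMk_eq_iff_of_map_eq hZ hm (hv _) hcop (hv0 _) h0 (by rw [hT, hW']) hW').mpr rfl)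
  exact ⟨κ, fun g => ⟨v g, hv g, hv0 g, hvg g, rfl⟩⟩

theorem mem_translates_self {Z : Module.End ℂ (Fin N → ℂ)} {m : ℂ[X]} (W : Gr M N) :
    W ∈ translates Z m W :=
  ⟨1, one_ne_zero, isCoprime_one_left, by rw [map_one]; exact Submodule.map_id _⟩

theorem translates_eq_of_mem {Z : Module.End ℂ (Fin N → ℂ)} {m : ℂ[X]} (hZ : aeval Z m = 0)
    (hm : m ≠ 0) {W W' : Gr M N} (h : W' ∈ translates Z m W) :
    translates Z m W' = translates Z m W := by
  obtain ⟨f, hf0, hf, hfW⟩ := h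
  obtain ⟨c, hc⟩ : ∃ g, g ≠ 0 ∧ IsCoprime g m ∧ W.1.map (aeval Z g) = W'.1 := by
    obtain ⟨g, hg, -, hgf⟩ := exists_aeval_inverse hZ hf
    have key : ∀ g, aeval Z (g * f) = 1 → W.1.map (aeval Z g) = W'.1 := fun g hgf => by
      rw [← hfW, ← map_aeval_mul, hgf]
      exact Submodule.map_id _
    -- The inverse can be 0 only if m is a unit; then m itself serves as a nonzero inverse.
    by_cases hg0 : g = 0
    · refine ⟨m, hm, ?_, key m ?_⟩
      · rw [hg0, isCoprime_zero_left] at hg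
        exact isCoprime_self.mpr hg
      · rw [map_mul, hZ, zero_mul, ← hgf, hg0, zero_mul, map_zero]
    · exact ⟨g, hg0, hg, key g hgf⟩
  ext Y
  constructor
  · rintro ⟨g, hg0, hg, hgY⟩
    exact ⟨f * g, mul_ne_zero hf0 hg0, hf.mul_left hg, by rw [map_aeval_mul, hgY, hfW]⟩
  · rintro ⟨g, hg0, hg, hgY⟩
    exact ⟨c * g, mul_ne_zero hc.1 hg0, hc.2.1.mul_left hg, by rw [map_aeval_mul, hgY, hc.2.2]⟩

/-- O and A enter through equations, so that every point W of one fixed orbit can serve as base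
point with the same O and A. -/
theorem exists_jac_equiv_orbit (φ : (Fin N → ℂ) ≃ₗ[ℂ] boundedCond μ) (W : Gr M N)
    {O : Set (Gr M N)} (hO : O = translates (mulZ φ) (boundPoly μ) W)
    {A : Subalgebra ℂ ℂ[X]} (hA : A = stab (mulZ φ) W.1) :
    ∃ (Φ : Jac A ≃ O) (κ : gammaPlus →* Multiplicative (Jac A)),
      IsMorphism (jacStructure A) (grStructure O) Φ ∧
      IsMorphism (grStructure O) (jacStructure A) Φ.symm ∧
      ∀ g : gammaPlus,
        condOf φ (Φ (κ g).toAdd).1 = (condOf φ W).map (act g.1) := by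
  subst hO hA
  have hZ := aeval_mulZ_boundPoly φ
  have hm := monic_boundPoly μ
  obtain ⟨Φ, hΦ⟩ := exists_jac_equiv_translates hm.ne_zero hZ W
  obtain ⟨κ, hκ⟩ := exists_hom_gammaPlus_jac φ W
  refine ⟨Φ, κ, isMorphism_jac_gr hm.ne_zero hZ W Φ hΦ, isMorphism_gr_jac hm hZ W Φ hΦ,
    fun g => ?_⟩
  obtain ⟨v, hv, hv0, hvg, h⟩ := hκ g
  rw [condOf_eq_map_act_iff φ g.2 hvg, h]
  exact hΦ v hv0 hv _

theorem isCurveOf_spectralRing_condOf (φ : (Fin N → ℂ) ≃ₗ[ℂ] boundedCond μ) (W : Gr M N) :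
    IsCurveOf M μ (spectralRing (condOf φ W)) := by
  refine ⟨condOf φ W, ?_, ?_, rfl⟩
  · rw [condOf_eq_map]
    rintro _ ⟨w, -, rfl⟩
    exact condInclusion_mem φ w
  · rw [condOf_eq_map, ← (Submodule.equivMapOfInjective _ (condInclusion_injective φ)
      W.1).finrank_eq, W.2]

theorem exists_condOf_eq (φ : (Fin N → ℂ) ≃ₗ[ℂ] boundedCond μ) {C : Submodule ℂ Cond}
    (hC : C ≤ boundedCond μ) (hM : Module.finrank ℂ C = M) : ∃ W : Gr M N, condOf φ W = C := by
  have h : (C.comap (condInclusion φ)).map (condInclusion φ) = C := by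
    rw [Submodule.map_comap_eq, inf_eq_right]
    intro c hc
    exact ⟨φ.symm ⟨c, hC hc⟩, by simp [condInclusion]⟩
  refine ⟨⟨C.comap (condInclusion φ), ?_⟩, ?_⟩
  · rw [(Submodule.equivMapOfInjective _ (condInclusion_injective φ) _).finrank_eq, h, hM]
  · rw [condOf_eq_map, h]

end Orbits
end DualGr
end

theorem mainTheorem7 (M N : ℕ) (hMN : M ≤ N) (μ : ℂ →₀ ℕ) (hμ : DualGr.dimBound μ = N) :
    Nonempty ((Fin N → ℂ) ≃ₗ[ℂ] DualGr.boundedCond μ) ∧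
    ∀ φ : (Fin N → ℂ) ≃ₗ[ℂ] DualGr.boundedCond μ,
      -- the group acts on the Grassmannian, and its orbits form a partition
      (∀ (W : DualGr.Gr M N), ∀ g ∈ DualGr.gammaPlus, ∃ W' : DualGr.Gr M N,
        DualGr.condOf φ W' = (DualGr.condOf φ W).map (DualGr.act g)) ∧
      Setoid.IsPartition (Set.range (DualGr.orbit (M := M) φ)) ∧
      -- each orbit is the generalized Jacobian of a curve represented by `M` conditions
      (∀ O ∈ Set.range (DualGr.orbit (M := M) φ), ∃ A : Subalgebra ℂ (Polynomial ℂ),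
        DualGr.IsCurveOf M μ A ∧ ∀ W ∈ O,
          DualGr.spectralRing (DualGr.condOf φ W) = A ∧
          ∃ (Φ : DualGr.Jac A ≃ O)
            (κ : DualGr.gammaPlus →* Multiplicative (DualGr.Jac A)),
            DualGr.IsMorphism (DualGr.jacStructure A) (DualGr.grStructure O) Φ ∧
            DualGr.IsMorphism (DualGr.grStructure O) (DualGr.jacStructure A) Φ.symm ∧
            ∀ g : DualGr.gammaPlus,
              DualGr.condOf φ (Φ (κ g).toAdd).1 = (DualGr.condOf φ W).map (DualGr.act g.1)) ∧
      -- all curves represented by `M` conditions bounded by `μ` occur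
      (∀ A : Subalgebra ℂ (Polynomial ℂ), DualGr.IsCurveOf M μ A →
        ∃ O ∈ Set.range (DualGr.orbit (M := M) φ), ∀ W ∈ O,
          DualGr.spectralRing (DualGr.condOf φ W) = A) := by
  refine ⟨DualGr.nonempty_equiv_boundedCond hμ, fun φ => ?_⟩
  have hZ := DualGr.aeval_mulZ_boundPoly φ
  have hm := (DualGr.monic_boundPoly μ).ne_zero
  have horbit := DualGr.orbit_eq_translates (M := M) φ
  have hring : ∀ W W' : DualGr.Gr M N, W ∈ DualGr.orbit φ W' →
      DualGr.spectralRing (DualGr.condOf φ W) = DualGr.spectralRing (DualGr.condOf φ W') := by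
    intro W W' h
    rw [horbit] at h
    obtain ⟨f, -, hf, hfW⟩ := h
    rw [DualGr.spectralRing_condOf, DualGr.spectralRing_condOf, DualGr.stab_eq_of_map_eq hZ hf hfW]
  refine ⟨fun W g hg => ?_, ⟨?_, fun W => ?_⟩, ?_, ?_⟩
  · obtain ⟨v, -, hv, hvg⟩ := DualGr.exists_unit_of_mem_gammaPlus μ hg
    obtain ⟨W', hW'⟩ := DualGr.exists_map_aeval_eq hZ W.1 hv
    refine ⟨⟨W', ?_⟩, (DualGr.condOf_eq_map_act_iff φ hg hvg W _).mpr hW'⟩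
    rw [← DualGr.finrank_map_aeval hZ W' hv, hW', W.2]
  · rintro ⟨W, hW⟩
    have := DualGr.mem_translates_self (Z := DualGr.mulZ φ) (m := DualGr.boundPoly μ) W
    rw [← horbit, hW] at this
    exact this
  · refine ⟨DualGr.orbit φ W, ⟨⟨W, rfl⟩, ?_⟩, ?_⟩
    · rw [horbit]
      exact DualGr.mem_translates_self W
    · rintro _ ⟨⟨W', rfl⟩, h⟩
      rw [horbit] at h
      rw [horbit, horbit, DualGr.translates_eq_of_mem hZ hm h]
  · rintro _ ⟨W₀, rfl⟩
    refine ⟨_, DualGr.isCurveOf_spectralRing_condOf φ W₀, fun W hW => ⟨hring W W₀ hW, ?_⟩⟩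
    refine DualGr.exists_jac_equiv_orbit φ W ?_ ?_
    · rw [horbit] at hW ⊢
      exact (DualGr.translates_eq_of_mem hZ hm hW).symm
    · rw [← hring W W₀ hW, DualGr.spectralRing_condOf]
  · rintro _ ⟨C, hC, hM, rfl⟩
    obtain ⟨W₀, rfl⟩ := DualGr.exists_condOf_eq φ hC hM
    exact ⟨_, ⟨W₀, rfl⟩, fun W hW => hring W W₀ hW⟩
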